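/- Let $S$ be a closed connected orientable surface of genus at least $2$. Let $\gamma_1,\dots,\gamma_n$ be essential simple closed curves in $S$, pairwise not freely homotopic even after reversing orientations, that are disjointly realizable, i.e. freely homotopic to pairwise disjoint simple closed curves. Let $\gamma$ be an essential oriented closed curve in $S$ (not necessarily simple or primitive), and let $X_1,X_2$ be marked hyperbolic structures on $S$. For $j=1,2$ let $\gamma_i^{X_j}$ and $\gamma^{X_j}$ be geodesic realizations of these curves on $X_j$, i.e. closed geodesics of constant nonzero speed, parametrized by $\mathbb R/\mathbb Z$, in the given oriented free homotopy classes. View $\gamma^{X_j}$ as a $1$-periodic map $\mathbb R\to S$. Then for each $j$ the transverse crossings of $\gamma^{X_j}$ with the curves $\gamma_1^{X_j},\dots,\gamma_n^{X_j}$ can be listed in order: there are an index set $I_j$, equal to $\emptyset$ or $\mathbb Z$, a strictly increasing family of times $(t_k)^{X_j}_{k\in I_j}$ and a family of indices $(c_k)^{X_j}_{k\in I_j}$ in $\{1,\dots,n\}$ such that $\gamma^{X_j}$ crosses $\gamma_i^{X_j}$ transversely at time $t$ if and only if $(t,i)=(t_k^{X_j},c_k^{X_j})$ for some $k \in I_j$.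 Moreover, for any such listings there is an order-preserving bijection $e:I_1\to I_2$ with $c_k^{X_1}=c_{e(k)}^{X_2}$ for all $k\in I_1$; and $e$ can be chosen compatible with traversals of $\gamma$, i.e. so that $t_l^{X_1}=t_k^{X_1}+1$ implies $t_{e(l)}^{X_2}=t_{e(k)}^{X_2}+1$. In particular the cyclic sequences of indices crossed during one traversal of $\gamma$ agree. -/

import Mathlib

open UpperHalfPlane
open scoped MatrixGroups

/-- A marked (complete, oriented) hyperbolic structure on `S`: an identification of `S` with a
quotient `ℍ / Γ` of the hyperbolic plane by a discrete torsion-free group `Γ` of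
orientation-preserving isometries, given as a covering map `proj : ℍ → S` whose fibres are the
orbits of the Möbius transformations `z ↦ A • z`, `A ∈ SL(2, ℝ)`, that preserve `proj`.
The space `S` is then automatically a connected orientable surface; if it is compact, its genus is
at least two. -/
structure MarkedHyperbolicStructure (S : Type*) [TopologicalSpace S] where
  /-- The uniformization. -/
  proj : ℍ → S
  isCoveringMap : IsCoveringMap proj
  surjective : Function.Surjective proj
  fiber : ∀ z w : ℍ, proj z = proj w →
    ∃ A : SL(2, ℝ), A • z = w ∧ ∀ u : ℍ, proj (A • u) = proj u

/-- An oriented, parametrized closed curve in `S`, defined on the circle `ℝ / ℤ`. -/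
abbrev ClosedCurve (S : Type*) [TopologicalSpace S] := C(UnitAddCircle, S)

namespace ClosedCurve

variable {S : Type*} [TopologicalSpace S]

/-- A closed curve is simple if it has no self-intersections. -/
def IsSimple (γ : ClosedCurve S) : Prop := Function.Injective γ

/-- The same curve with the opposite orientation. -/
def reverse (γ : ClosedCurve S) : ClosedCurve S :=
  γ.comp ⟨fun x : UnitAddCircle => -x, continuous_neg⟩

/-- A family of closed curves is disjointly realizable if its members are freely homotopic to
simple closed curves that are pairwise disjoint. -/
def DisjointlyRealizable {n : ℕ} (γ : Fin n → ClosedCurve S) : Prop :=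
  ∃ δ : Fin n → ClosedCurve S,
    (∀ i, (γ i).Homotopic (δ i)) ∧ (∀ i, (δ i).IsSimple) ∧
      ∀ i j, i ≠ j → Disjoint (Set.range (δ i)) (Set.range (δ j))

/-- The members of a family represent distinct unoriented free homotopy classes. -/
def PairwiseDistinct {n : ℕ} (γ : Fin n → ClosedCurve S) : Prop :=
  ∀ i j, i ≠ j → ¬ (γ i).Homotopic (γ j) ∧ ¬ (γ i).Homotopic (γ j).reverse

end ClosedCurve

/-- A complete geodesic of the hyperbolic plane, parametrized with constant nonzero speed. -/
def IsGeodesicLine (g : ℝ → ℍ) : Prop :=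
  ∃ v : ℝ, 0 < v ∧ ∀ s t : ℝ, dist (g s) (g t) = v * |s - t|

namespace MarkedHyperbolicStructure

variable {S : Type*} [TopologicalSpace S] (X : MarkedHyperbolicStructure S)

/-- `g` is a geodesic line in `ℍ` lifting the closed curve `a`. -/
def IsGeodesicLift (a : ClosedCurve S) (g : ℝ → ℍ) : Prop :=
  IsGeodesicLine g ∧ ∀ t : ℝ, X.proj (g t) = a (t : UnitAddCircle)

/-- `a` is a closed geodesic (of constant nonzero speed, not necessarily primitive) on `X`. -/
def IsClosedGeodesic (a : ClosedCurve S) : Prop :=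
  ∃ g : ℝ → ℍ, X.IsGeodesicLift a g

/-- `a` is a geodesic realization on `X` of the closed curve `γ`: a closed geodesic in its (oriented)
free homotopy class. -/
def IsGeodesicRealization (γ a : ClosedCurve S) : Prop :=
  X.IsClosedGeodesic a ∧ γ.Homotopic a

/-- At time `t` the closed geodesic `a` crosses the closed geodesic `b` transversely: some lifts
of `a` and `b` to `ℍ` meet at time `t` of `a`, and they are different geodesic lines. -/
def CrossesAt (a b : ClosedCurve S) (t : ℝ) : Prop :=
  ∃ g h : ℝ → ℍ, X.IsGeodesicLift a g ∧ X.IsGeodesicLift b h ∧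
    (∃ s : ℝ, g t = h s) ∧ Set.range g ≠ Set.range h

/-- The crossings of `a` with the members of the family `b`, as the parameter of `a` runs through
`ℝ`, listed in order: `time k` is the time and `index k` the index of the curve crossed at the
`k`-th crossing, and every crossing is listed exactly once. -/
structure CrossingSequence {n : ℕ} (a : ClosedCurve S) (b : Fin n → ClosedCurve S)
    (I : Type) [LinearOrder I] where
  time : I → ℝ
  strictMono_time : StrictMono time
  index : I → Fin n
  crossesAt_iff : ∀ (t : ℝ) (i : Fin n),
    X.CrossesAt a (b i) t ↔ ∃ k : I, time k = t ∧ index k = i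

end MarkedHyperbolicStructure

/-! Two markings are related by a homeomorphism `φ` of the universal cover that intertwines the deck
groups. Since `S` is compact, `φ` and its inverse move points at bounded distance to points at
bounded distance (`exists_dist_le`). Lifting homotopies gives each geodesic lift `g` on the first
surface a partner `g'` on the second, at bounded distance from `φ ∘ g`.

A crossing is visible from far away: `g` crosses `h` transversely exactly when it runs arbitrarily
far into both sides of `h`. Far from `h`, `φ` carries the two sides of `h` to the two sides of `h'`
(`exists_side`). Hence `g'` changes side and crosses `h'` (`exists_crossing_of_crossing`).

Order is preserved because lifts of the curves of the family either coincide or are disjoint. A lift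
`h₂` met by `g` after `h₁` lies wholly on the side of `h₁` that `g` enters; far points show that
`h₂'` lies on the matching side of `h₁'` (`lt_of_crossing_lt`).

That dichotomy comes from the disjoint simple curves: crossing geodesics would force the
corresponding lifts of these curves to cross, by a Poincaré–Miranda argument (`range_eq_of_meet`).
Two different indices cannot share a line either: simplicity makes both geodesics primitive, so they
would be homotopic up to orientation. Thus a crossing time determines its index.

Crossing times are locally finite and invariant under integer translation, hence either absent or
ordered like `ℤ`. The boundary at infinity is never used; sides and ends are measured by `slope` and
`axialCoord` after moving a line to the imaginary axis. -/

/-! ### Coordinates adapted to the imaginary axis -/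

namespace UpperHalfPlane

/-- The ratio `re z / im z`, the hyperbolic sine of the signed distance of `z` to the imaginary
axis. -/
noncomputable def slope (z : ℍ) : ℝ := z.re / z.im

/-- The logarithm of `‖z‖`, the position along the imaginary axis of the projection of `z`. -/
noncomputable def axialCoord (z : ℍ) : ℝ := Real.log ‖(z : ℂ)‖

/-- The unit speed parametrization of the imaginary axis. -/
noncomputable def axis (u : ℝ) : ℍ := ⟨⟨0, Real.exp u⟩, Real.exp_pos u⟩

@[simp] lemma axis_re (u : ℝ) : (axis u).re = 0 := rfl
@[simp] lemma axis_im (u : ℝ) : (axis u).im = Real.exp u := rfl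
@[simp] lemma slope_axis (u : ℝ) : slope (axis u) = 0 := by simp [slope]

lemma norm_sq_eq (z : ℍ) : ‖(z : ℂ)‖ ^ 2 = z.re ^ 2 + z.im ^ 2 := by
  rw [Complex.sq_norm, Complex.normSq_apply]; simp [sq]

lemma norm_coe_pos (z : ℍ) : 0 < ‖(z : ℂ)‖ := norm_pos_iff.2 z.ne_zero

lemma axialCoord_eq (z : ℍ) : axialCoord z = Real.log (z.re ^ 2 + z.im ^ 2) / 2 := by
  rw [← norm_sq_eq, Real.log_pow, axialCoord]; simp

@[simp] lemma axialCoord_axis (u : ℝ) : axialCoord (axis u) = u := by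
  rw [axialCoord_eq]; simp

lemma continuous_slope : Continuous slope :=
  continuous_re.div continuous_im fun z => z.im_ne_zero

lemma continuous_axialCoord : Continuous axialCoord :=
  (continuous_coe.norm).log fun z => (norm_coe_pos z).ne'

lemma dist_axis (u v : ℝ) : dist (axis u) (axis v) = |u - v| :=
  (isometry_vertical_line 0).dist_eq u v

lemma axis_injective : Function.Injective axis := fun u v h => by
  simpa using congrArg axialCoord h

lemma ext_slope_axialCoord {z w : ℍ} (hs : slope z = slope w)
    (ha : axialCoord z = axialCoord w) : z = w := by
  have h1 : ‖(z : ℂ)‖ = ‖(w : ℂ)‖ := Real.log_injOn_pos (norm_coe_pos z) (norm_coe_pos w) ha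
  have h2 := norm_sq_eq z
  rw [h1, norm_sq_eq w] at h2
  have hz := z.im_pos
  have hw := w.im_pos
  rw [slope, slope, div_eq_div_iff hz.ne' hw.ne'] at hs
  have h3 : z.im ^ 2 = w.im ^ 2 := by
    have : z.im ^ 2 * (w.re ^ 2 + w.im ^ 2) = w.im ^ 2 * (w.re ^ 2 + w.im ^ 2) := by
      calc z.im ^ 2 * (w.re ^ 2 + w.im ^ 2) = (w.re * z.im) ^ 2 + z.im ^ 2 * w.im ^ 2 := by ring
        _ = (z.re * w.im) ^ 2 + z.im ^ 2 * w.im ^ 2 := by rw [hs]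
        _ = w.im ^ 2 * (z.re ^ 2 + z.im ^ 2) := by ring
        _ = _ := by rw [← h2]
    exact mul_right_cancel₀ (by positivity) this
  have h4 : z.im = w.im := by
    rwa [sq_eq_sq₀ hz.le hw.le] at h3
  rw [h4] at hs
  exact ext_re_im (mul_right_cancel₀ hw.ne' hs) h4

lemma eq_axis_of_slope_eq_zero {z : ℍ} (h : slope z = 0) : z = axis (axialCoord z) :=
  ext_slope_axialCoord (by simp [h]) (by simp)

lemma cosh_dist_eq (z w : ℍ) : 2 * z.im * w.im * Real.cosh (dist z w) =
    ‖(z : ℂ)‖ ^ 2 + ‖(w : ℂ)‖ ^ 2 - 2 * (z.re * w.re) := by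
  have hz := z.im_pos
  have hw := w.im_pos
  rw [cosh_dist', norm_sq_eq, norm_sq_eq]
  field_simp
  ring

lemma im_le_norm (z : ℍ) : z.im ≤ ‖(z : ℂ)‖ := by
  have := norm_sq_eq z
  exact abs_le_of_sq_le_sq' (by nlinarith [sq_nonneg z.re]) (norm_nonneg _) |>.2

lemma abs_re_le_norm (z : ℍ) : |z.re| ≤ ‖(z : ℂ)‖ := Complex.abs_re_le_norm z

/-- A segment between opposite sides meets the axis, so its length is at least the distance from `z`
to the axis. The sharp bound would be `sinh`; the cruder `cosh` follows from `cosh_dist_eq` by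
dropping the term in the real parts. -/
lemma abs_slope_le_cosh_dist {z w : ℍ} (h : slope z * slope w ≤ 0) :
    |slope z| ≤ Real.cosh (dist z w) := by
  have hz := z.im_pos
  have hw := w.im_pos
  have h1 : z.re * w.re ≤ 0 := by
    have : z.re * w.re = (slope z * slope w) * (z.im * w.im) := by
      simp only [slope]; field_simp
    rw [this]
    exact mul_nonpos_of_nonpos_of_nonneg h (by positivity)
  have h2 := cosh_dist_eq z w
  have h3 : |z.re| * w.im ≤ z.im * w.im * Real.cosh (dist z w) := by
    have := mul_le_mul (abs_re_le_norm z) (im_le_norm w) hw.le (norm_nonneg _)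
    nlinarith [sq_nonneg (‖(z : ℂ)‖ - ‖(w : ℂ)‖)]
  rw [slope, abs_div, abs_of_pos hz, div_le_iff₀ hz]
  nlinarith

lemma norm_le_mul_norm (z w : ℍ) :
    ‖(z : ℂ)‖ ≤ 2 * Real.cosh (dist z w) * ‖(w : ℂ)‖ := by
  have hz := norm_coe_pos z
  have hw := norm_coe_pos w
  have h2 := cosh_dist_eq z w
  have h3 : z.im * w.im ≤ ‖(z : ℂ)‖ * ‖(w : ℂ)‖ :=
    mul_le_mul (im_le_norm z) (im_le_norm w) w.im_pos.le hz.le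
  have h4 : z.re * w.re + z.im * w.im ≤ ‖(z : ℂ)‖ * ‖(w : ℂ)‖ := by
    have := norm_sq_eq z
    have := norm_sq_eq w
    refine abs_le_of_sq_le_sq' ?_ (by positivity) |>.2
    rw [mul_pow, norm_sq_eq, norm_sq_eq]
    nlinarith [sq_nonneg (z.re * w.im - z.im * w.re)]
  have h1 := Real.one_le_cosh (dist z w)
  have h5 : ‖(z : ℂ)‖ ^ 2 ≤ ‖(z : ℂ)‖ * (2 * Real.cosh (dist z w) * ‖(w : ℂ)‖) := by
    nlinarith [mul_nonneg (sub_nonneg.2 h1) (sub_nonneg.2 h3), sq_nonneg ‖(w : ℂ)‖]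
  rw [sq] at h5
  exact le_of_mul_le_mul_left h5 hz

lemma abs_axialCoord_sub_le (z w : ℍ) :
    |axialCoord z - axialCoord w| ≤ Real.log (2 * Real.cosh (dist z w)) := by
  have key : ∀ z w : ℍ, axialCoord z - axialCoord w ≤ Real.log (2 * Real.cosh (dist z w)) := by
    intro z w
    rw [sub_le_iff_le_add, axialCoord, axialCoord,
      ← Real.log_mul (by positivity) (norm_coe_pos w).ne']
    exact Real.log_le_log (norm_coe_pos z) (norm_le_mul_norm z w)
  refine abs_le.2 ⟨?_, key z w⟩
  have := key w z
  rw [dist_comm] at this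
  linarith

lemma exists_abs_axialCoord_sub_le (K : ℝ) :
    ∃ C, ∀ z w : ℍ, dist z w ≤ K → |axialCoord z - axialCoord w| ≤ C := by
  refine ⟨Real.log (2 * Real.cosh K), fun z w h => (abs_axialCoord_sub_le z w).trans ?_⟩
  have : Real.cosh (dist z w) ≤ Real.cosh K :=
    Real.cosh_le_cosh.2 (by rw [abs_of_nonneg dist_nonneg]; exact h.trans (le_abs_self K))
  exact Real.log_le_log (by positivity) (by linarith)

/-- For the point of the axis with the same norm, `cosh d = ‖z‖ / im z`, and `d ≤ sinh d < cosh d`.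
-/
lemma dist_axis_axialCoord_le (z : ℍ) :
    dist z (axis (axialCoord z)) ≤ |slope z| + 1 := by
  have hz := z.im_pos
  have hn := norm_coe_pos z
  have h := cosh_dist_eq z (axis (axialCoord z))
  have h1 : ‖(axis (axialCoord z) : ℂ)‖ = ‖(z : ℂ)‖ := by
    apply Real.log_injOn_pos (norm_coe_pos _) hn
    exact axialCoord_axis _
  have h2 : Real.exp (axialCoord z) = ‖(z : ℂ)‖ := by rw [axialCoord, Real.exp_log hn]
  rw [h1, axis_re, axis_im, h2] at h
  have h3 : z.im * Real.cosh (dist z (axis (axialCoord z))) = ‖(z : ℂ)‖ := by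
    have : ‖(z : ℂ)‖ * (z.im * Real.cosh (dist z (axis (axialCoord z)))) =
      ‖(z : ℂ)‖ * ‖(z : ℂ)‖ := by linarith
    exact mul_left_cancel₀ hn.ne' this
  have h4 : ‖(z : ℂ)‖ ≤ |z.re| + z.im := by
    have := Complex.norm_le_abs_re_add_abs_im z
    rwa [coe_re, coe_im, abs_of_pos hz] at this
  have h5 : Real.cosh (dist z (axis (axialCoord z))) ≤ |slope z| + 1 := by
    rw [slope, abs_div, abs_of_pos hz, div_add_one hz.ne', le_div_iff₀ hz]
    linarith
  refine le_trans ?_ h5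
  set d := dist z (axis (axialCoord z))
  have hd : 0 ≤ d := dist_nonneg
  exact (Real.self_le_sinh_iff.2 hd).trans (Real.sinh_lt_cosh d).le

/-- A point whose distance from `z` is bounded lies on the same side of the imaginary axis as `z`
and far from it, provided that `z` is far enough from it. -/
lemma exists_slope_gt (K B : ℝ) : ∃ R, ∀ z w : ℍ, dist z w ≤ K →
    (R < slope z → B < slope w) ∧ (slope z < -R → slope w < -B) := by
  -- If `|slope w| ≤ |B|`, then `w` is within `|B| + 1` of the axis and `z` within `|K| + |B| + 1`,
  -- which bounds `|slope z|` by this `R`.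
  set R := Real.cosh (|K| + (|B| + 1)) with hR
  have key : ∀ z w : ℍ, dist z w ≤ K → R < |slope z| → |B| < |slope w| ∧ 0 < slope z * slope w := by
    intro z w h hz
    have hK : dist z w ≤ |K| := h.trans (le_abs_self K)
    have mono : ∀ x, 0 ≤ x → x ≤ |K| + (|B| + 1) → Real.cosh x ≤ R := fun x hx hx' =>
      Real.cosh_le_cosh.2 (by rw [abs_of_nonneg hx, abs_of_nonneg (by positivity)]; exact hx')
    constructor
    · by_contra! hw
      have h1 := dist_axis_axialCoord_le w
      have h2 : |slope z| ≤ Real.cosh (dist z (axis (axialCoord w))) :=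
        abs_slope_le_cosh_dist (by simp)
      have h3 := mono _ dist_nonneg
        ((dist_triangle z w (axis (axialCoord w))).trans (add_le_add hK (h1.trans (by linarith))))
      linarith
    · by_contra! hw
      have h2 := abs_slope_le_cosh_dist hw
      have h3 := mono _ dist_nonneg (hK.trans (by linarith [abs_nonneg B]))
      linarith
  have hR0 : 0 < R := Real.cosh_pos _
  refine ⟨R, fun z w h => ⟨fun hz => ?_, fun hz => ?_⟩⟩
  · obtain ⟨h1, h2⟩ := key z w h (hz.trans_le (le_abs_self _))
    have h3 : 0 < slope w := (pos_iff_pos_of_mul_pos h2).1 (hR0.trans hz)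
    rw [abs_of_pos h3] at h1
    exact (le_abs_self B).trans_lt h1
  · obtain ⟨h1, h2⟩ := key z w h (lt_of_lt_of_le (by linarith) (neg_le_abs _))
    have h3 : slope w < 0 := (neg_iff_neg_of_mul_pos h2).1 (by linarith)
    rw [abs_of_neg h3] at h1
    linarith [le_abs_self B]

/-! ### The Möbius action in these coordinates -/

section Moebius

variable (A : SL(2, ℝ)) (z : ℍ)

lemma re_im_smul : ∃ N : ℝ, 0 < N ∧ N = (A 1 0 * z.re + A 1 1) ^ 2 + (A 1 0 * z.im) ^ 2 ∧
    (A • z).im = z.im / N ∧ (A • z).re =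
      (A 0 0 * A 1 0 * (z.re ^ 2 + z.im ^ 2) + (A 0 0 * A 1 1 + A 0 1 * A 1 0) * z.re +
        A 0 1 * A 1 1) / N := by
  have hdet : A 0 0 * A 1 1 - A 0 1 * A 1 0 = 1 := by
    rw [← Matrix.det_fin_two]; exact A.2
  have hz := z.im_pos
  have hN : 0 < (A 1 0 * z.re + A 1 1) ^ 2 + (A 1 0 * z.im) ^ 2 := by
    by_cases hc : A 1 0 = 0
    · have : A 1 1 ≠ 0 := by rintro h; simp [hc, h] at hdet
      simp only [hc, zero_mul, zero_add]; positivity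
    · positivity
  have hcoe := coe_specialLinearGroup_apply A z
  have hns : Complex.normSq ((A 1 0 : ℂ) * z + (A 1 1 : ℂ)) =
      (A 1 0 * z.re + A 1 1) ^ 2 + (A 1 0 * z.im) ^ 2 := by
    rw [Complex.normSq_apply]; simp; ring
  refine ⟨_, hN, rfl, ?_, ?_⟩
  · rw [← coe_im, hcoe, Complex.div_im]
    simp only [Algebra.algebraMap_self, RingHom.id_apply]
    rw [hns]
    simp
    linear_combination (z.im / ((A 1 0 * z.re + A 1 1) ^ 2 + (A 1 0 * z.im) ^ 2)) * hdet
  · rw [← coe_re, hcoe, Complex.div_re]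
    simp only [Algebra.algebraMap_self, RingHom.id_apply]
    rw [hns]
    simp
    field_simp
    ring

lemma slope_smul : slope (A • z) =
    (A 0 0 * A 1 0 * (z.re ^ 2 + z.im ^ 2) + (A 0 0 * A 1 1 + A 0 1 * A 1 0) * z.re +
        A 0 1 * A 1 1) / z.im := by
  obtain ⟨N, hN, -, h1, h2⟩ := re_im_smul A z
  have := z.im_pos
  rw [slope, h1, h2]
  field_simp

/-- Geodesics are Möbius images of the axis, so this two-exponential form governs every geodesic. A
coefficient vanishes when the corresponding end of the image is `0` or `∞`. -/
lemma slope_smul_axis (u : ℝ) : slope (A • axis u) =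
    A 0 0 * A 1 0 * Real.exp u + A 0 1 * A 1 1 * Real.exp (-u) := by
  rw [slope_smul, Real.exp_neg]
  simp
  field_simp

end Moebius

end UpperHalfPlane

/-! ### Moving geodesics to the imaginary axis -/

namespace UpperHalfPlane

/-- The rotation about `i` by the angle `2 * θ`. -/
noncomputable def rotation (θ : ℝ) : SL(2, ℝ) :=
  ⟨!![Real.cos θ, Real.sin θ; -Real.sin θ, Real.cos θ], by
    rw [Matrix.det_fin_two_of]; nlinarith [Real.sin_sq_add_cos_sq θ]⟩

lemma rotation_smul_axis_zero (θ : ℝ) : rotation θ • axis 0 = axis 0 := by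
  obtain ⟨N, -, hN, h1, h2⟩ := re_im_smul (rotation θ) (axis 0)
  have : N = 1 := by rw [hN]; simp [rotation]
  subst this
  refine ext_re_im ?_ ?_
  · rw [h2]; simp [rotation]; ring
  · rw [h1]; simp

lemma slope_rotation_smul (θ : ℝ) (z : ℍ) : slope (rotation θ • z) =
    (Real.sin θ * Real.cos θ * (1 - (z.re ^ 2 + z.im ^ 2)) +
      (Real.cos θ ^ 2 - Real.sin θ ^ 2) * z.re) / z.im := by
  rw [slope_smul]; simp [rotation]; ring

lemma rotation_pi_div_two_smul_axis (u : ℝ) : rotation (Real.pi / 2) • axis u = axis (-u) := by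
  obtain ⟨N, -, hN, h1, h2⟩ := re_im_smul (rotation (Real.pi / 2)) (axis u)
  refine ext_re_im ?_ ?_
  · rw [h2]; simp [rotation]
  · rw [h1, hN]; simp [rotation, Real.exp_neg]
    field_simp

lemma exists_smul_eq_axis (p q : ℍ) :
    ∃ M : SL(2, ℝ), M • p = axis 0 ∧ M • q = axis (dist p q) := by
  obtain ⟨M₀, hM₀⟩ := MulAction.exists_smul_eq SL(2, ℝ) p (axis 0)
  -- At `θ = π / 2` the rotation is the half-turn about `i`, which negates the slope of this point;
  -- the intermediate value theorem applies.
  have hrot : ∃ θ, slope (rotation θ • (M₀ • q)) = 0 := by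
    have hcont : Continuous fun θ => slope (rotation θ • (M₀ • q)) := by
      simp only [slope_rotation_smul]
      fun_prop
    have h0 : slope (rotation 0 • (M₀ • q)) = slope (M₀ • q) := by
      rw [slope_rotation_smul]; simp [slope]
    have h1 : slope (rotation (Real.pi / 2) • (M₀ • q)) = -slope (M₀ • q) := by
      rw [slope_rotation_smul]; simp [slope]; ring
    rcases le_total 0 (slope (M₀ • q)) with h | h
    · exact mem_range_of_exists_le_of_exists_ge hcont ⟨Real.pi / 2, by simp [h1, h]⟩
        ⟨0, by simp [h0, h]⟩
    · exact mem_range_of_exists_le_of_exists_ge hcont ⟨0, by simp [h0, h]⟩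
        ⟨Real.pi / 2, by simp [h1, h]⟩
  obtain ⟨θ, hθ⟩ := hrot
  have hp : (rotation θ * M₀) • p = axis 0 := by
    rw [mul_smul, hM₀, rotation_smul_axis_zero]
  have hq := eq_axis_of_slope_eq_zero hθ
  rw [← mul_smul] at hq
  set M₁ := rotation θ * M₀
  set u := axialCoord (M₁ • q)
  have hd : dist p q = |u| := by
    rw [← dist_smul M₁ p q, hp, hq, dist_axis]; simp
  rcases le_total 0 u with hu | hu
  · exact ⟨M₁, hp, by rw [hd, abs_of_nonneg hu, hq]⟩
  · refine ⟨rotation (Real.pi / 2) * M₁, ?_, ?_⟩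
    · rw [mul_smul, hp, rotation_smul_axis_zero]
    · rw [mul_smul, hq, rotation_pi_div_two_smul_axis, hd, abs_of_nonpos hu]

lemma eq_axis_of_dist_eq {z : ℍ} {v x : ℝ} (hv : 0 < v) (h0 : dist z (axis 0) = |x|)
    (h1 : dist z (axis v) = |x - v|) : z = axis x := by
  have hy := z.im_pos
  have e0 := cosh_dist_eq z (axis 0)
  have e1 := cosh_dist_eq z (axis v)
  rw [h0, Real.cosh_abs, Real.cosh_eq, norm_sq_eq, norm_sq_eq] at e0
  rw [h1, Real.cosh_abs, Real.cosh_eq, norm_sq_eq, norm_sq_eq] at e1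
  simp only [axis_re, axis_im, neg_sub, Real.exp_sub, Real.exp_neg, Real.exp_zero] at e0 e1
  have hx := Real.exp_pos x
  have hE : 1 < Real.exp v := Real.one_lt_exp_iff.2 hv
  have him : z.im = Real.exp x := by
    set a := Real.exp x
    set b := Real.exp v
    have hb : 0 < b := by linarith
    field_simp at e0 e1
    have : (z.im - a) * (b ^ 2 - 1) = 0 := by linear_combination e1 - e0
    rcases mul_eq_zero.1 this with h | h
    · linarith
    · nlinarith
  have hre : z.re = 0 := by
    rw [him] at e0
    field_simp at e0
    have : z.re ^ 2 = 0 := by nlinarith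
    simpa using this
  exact ext_re_im hre him

end UpperHalfPlane

/-! ### Position of one geodesic relative to another -/

namespace IsGeodesicLine

lemma continuous {g : ℝ → ℍ} (hg : IsGeodesicLine g) : Continuous g := by
  obtain ⟨v, hv, h⟩ := hg
  refine (LipschitzWith.of_dist_le_mul (K := ⟨v, hv.le⟩) fun s t => ?_).continuous
  rw [h, Real.dist_eq]; rfl

lemma exists_smul_eq_axis {g : ℝ → ℍ} (hg : IsGeodesicLine g) :
    ∃ (M : SL(2, ℝ)) (v : ℝ), 0 < v ∧ ∀ t, M • g t = axis (v * t) := by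
  obtain ⟨v, hv, h⟩ := hg
  obtain ⟨M, h0, h1⟩ := UpperHalfPlane.exists_smul_eq_axis (g 0) (g 1)
  have hd : dist (g 0) (g 1) = v := by rw [h]; simp
  rw [hd] at h1
  refine ⟨M, v, hv, fun t => eq_axis_of_dist_eq hv ?_ ?_⟩
  · rw [← h0, dist_smul, h, sub_zero, abs_mul, abs_of_pos hv]
  · rw [← h1, dist_smul, h, ← abs_of_pos hv, ← abs_mul, abs_of_pos hv]
    congr 1; ring

lemma smul {g : ℝ → ℍ} (hg : IsGeodesicLine g) (A : SL(2, ℝ)) :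
    IsGeodesicLine fun t => A • g t := by
  obtain ⟨v, hv, h⟩ := hg
  exact ⟨v, hv, fun s t => by rw [dist_smul, h]⟩

lemma comp_add {g : ℝ → ℍ} (hg : IsGeodesicLine g) (c : ℝ) :
    IsGeodesicLine fun t => g (t + c) := by
  obtain ⟨v, hv, h⟩ := hg
  exact ⟨v, hv, fun s t => by rw [h]; congr 2; ring⟩

/-- The slope along a geodesic, and the position of its projection to the imaginary axis. -/
lemma exists_slope_eq {g : ℝ → ℍ} (hg : IsGeodesicLine g) (M : SL(2, ℝ)) :
    ∃ w α β : ℝ, 0 < w ∧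
      (∀ t, slope (M • g t) = α * Real.exp (w * t) + β * Real.exp (-(w * t))) ∧
      (α ≠ 0 → β ≠ 0 → ∃ C, ∀ t, |axialCoord (M • g t)| ≤ C) := by
  obtain ⟨P, w, hw, hP⟩ := hg.exists_smul_eq_axis
  have hg' : ∀ t, M • g t = (M * P⁻¹) • axis (w * t) := fun t => by
    rw [mul_smul, ← hP, inv_smul_smul]
  set A := M * P⁻¹
  refine ⟨w, A 0 0 * A 1 0, A 0 1 * A 1 1, hw, fun t => ?_, fun h1 h2 => ?_⟩
  · rw [hg', slope_smul_axis]
  · have ha : A 0 0 ≠ 0 := left_ne_zero_of_mul h1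
    have hc : A 1 0 ≠ 0 := right_ne_zero_of_mul h1
    have hb : A 0 1 ≠ 0 := left_ne_zero_of_mul h2
    have hd : A 1 1 ≠ 0 := right_ne_zero_of_mul h2
    have hdet : A 0 0 * A 1 1 - A 0 1 * A 1 0 = 1 := by
      rw [← Matrix.det_fin_two]; exact A.2
    have hq : ∀ t, axialCoord (M • g t) =
        Real.log ((A 0 0 ^ 2 * Real.exp (w * t) ^ 2 + A 0 1 ^ 2) /
          (A 1 0 ^ 2 * Real.exp (w * t) ^ 2 + A 1 1 ^ 2)) / 2 := fun t => by
      obtain ⟨N, hN, hN', e1, e2⟩ := re_im_smul A (axis (w * t))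
      rw [hg', axialCoord_eq, e1, e2]
      congr 2
      simp only [axis_re, axis_im, mul_zero, zero_add, add_zero] at hN' ⊢
      have hN'' : A 1 0 ^ 2 * Real.exp (w * t) ^ 2 + A 1 1 ^ 2 = N := by rw [hN']; ring
      rw [hN'', div_pow, div_pow, ← add_div, div_eq_div_iff (by positivity) hN.ne']
      rw [← hN'']
      generalize Real.exp (w * t) = E
      linear_combination (-(A 1 0 ^ 2 * E ^ 2 + A 1 1 ^ 2) * E ^ 2 *
        (A 0 0 * A 1 1 - A 0 1 * A 1 0 + 1)) * hdet
    generalize A 0 0 = a at *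
    generalize A 0 1 = b at *
    generalize A 1 0 = c at *
    generalize A 1 1 = d at *
    refine ⟨(|Real.log (a ^ 2 / c ^ 2 + b ^ 2 / d ^ 2)| +
      |Real.log (c ^ 2 / a ^ 2 + d ^ 2 / b ^ 2)|) / 2, fun t => ?_⟩
    rw [hq, abs_div, abs_two]
    gcongr
    have hE := Real.exp_pos (w * t)
    generalize Real.exp (w * t) = E at hE
    -- The quotient is bounded termwise from above; exchanging the two rows bounds its inverse,
    -- hence gives the lower bound.
    have key : ∀ a b c d : ℝ, a ≠ 0 → b ≠ 0 → c ≠ 0 → d ≠ 0 →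
        Real.log ((a ^ 2 * E ^ 2 + b ^ 2) / (c ^ 2 * E ^ 2 + d ^ 2)) ≤
          |Real.log (a ^ 2 / c ^ 2 + b ^ 2 / d ^ 2)| := by
      intro a b c d ha hb hc hd
      refine (Real.log_le_log (by positivity) ?_).trans (le_abs_self _)
      rw [add_div]
      gcongr ?_ + ?_
      · rw [div_le_div_iff₀ (by positivity) (by positivity)]
        nlinarith [mul_pos (sq_pos_of_ne_zero ha) (sq_pos_of_ne_zero hd)]
      · gcongr
        nlinarith [mul_pos (sq_pos_of_ne_zero hc) (sq_pos_of_ne_zero hE.ne')]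
    refine abs_le.2 ⟨?_, (key a b c d ha hb hc hd).trans (le_add_of_nonneg_right (abs_nonneg _))⟩
    have := key c d a b hc hd ha hb
    rw [← inv_div, Real.log_inv] at this
    linarith [abs_nonneg (Real.log (a ^ 2 / c ^ 2 + b ^ 2 / d ^ 2))]

/-- The zero at `t₀` forces `β = -α * exp (w * t₀) ^ 2`, which turns the two exponentials into one
`sinh`. So a transverse geodesic passes exactly once from one side to the other, and its projection
to the axis stays bounded. -/
lemma exists_slope_eq_sinh {g : ℝ → ℍ} (hg : IsGeodesicLine g) (M : SL(2, ℝ)) {t₀ : ℝ}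
    (h₀ : slope (M • g t₀) = 0) (hne : ∃ t, slope (M • g t) ≠ 0) :
    ∃ κ w : ℝ, κ ≠ 0 ∧ 0 < w ∧ (∀ t, slope (M • g t) = κ * Real.sinh (w * (t - t₀))) ∧
      ∃ C, ∀ t, |axialCoord (M • g t)| ≤ C := by
  obtain ⟨w, α, β, hw, hs, hC⟩ := hg.exists_slope_eq M
  have e0 := hs t₀
  rw [h₀] at e0
  have hE := Real.exp_pos (w * t₀)
  have hβ : β = -α * Real.exp (w * t₀) ^ 2 := by
    rw [Real.exp_neg] at e0
    field_simp at e0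
    linarith
  have hα : α ≠ 0 := by
    rintro rfl
    obtain ⟨t, ht⟩ := hne
    apply ht
    rw [hs, hβ]; simp
  refine ⟨2 * α * Real.exp (w * t₀), w, by positivity, hw, fun t => ?_,
    hC hα (by rw [hβ]; simp [hα])⟩
  rw [hs, hβ, Real.sinh_eq, mul_sub, neg_sub, Real.exp_sub, Real.exp_sub, Real.exp_neg]
  field_simp
  ring

lemma slope_eq_zero_of_two_zeros {g : ℝ → ℍ} (hg : IsGeodesicLine g) (M : SL(2, ℝ))
    {s t : ℝ} (hst : s ≠ t) (hs : slope (M • g s) = 0) (ht : slope (M • g t) = 0) (u : ℝ) :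
    slope (M • g u) = 0 := by
  by_contra hu
  obtain ⟨κ, w, hκ, hw, h, -⟩ := hg.exists_slope_eq_sinh M hs ⟨u, hu⟩
  rw [h] at ht
  simp [hκ, hw.ne', sub_eq_zero, hst.symm] at ht

/-- A combination of `exp x` and `exp (-x)` that is bounded on `ℝ` vanishes: a geodesic staying near
a line lies in it. -/
lemma exists_slope_gt {g : ℝ → ℍ} (hg : IsGeodesicLine g) (M : SL(2, ℝ))
    (hne : ∃ t, slope (M • g t) ≠ 0) (R : ℝ) : ∃ t, R < |slope (M • g t)| := by
  obtain ⟨w, α, β, hw, hs, -⟩ := hg.exists_slope_eq M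
  by_contra! hR
  have hsum : ∀ x : ℝ, |α * Real.exp x + β * Real.exp (-x)| ≤ R := fun x => by
    have := hR (x / w)
    rwa [hs, mul_div_cancel₀ _ hw.ne'] at this
  have key : ∀ α β : ℝ, (∀ x : ℝ, |α * Real.exp x + β * Real.exp (-x)| ≤ R) → α = 0 := by
    intro α β h
    by_contra hα
    have hα' := abs_pos.2 hα
    obtain ⟨x, hx0, hx⟩ : ∃ x : ℝ, 0 ≤ x ∧ (R + |β|) / |α| < x :=
      ⟨max 0 ((R + |β|) / |α| + 1), le_max_left _ _, by
        exact lt_of_lt_of_le (by linarith) (le_max_right _ _)⟩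
    have h1 := h x
    have h2 : |α| * Real.exp x ≤ |α * Real.exp x + β * Real.exp (-x)| + |β| := by
      have e1 : |β * Real.exp (-x)| ≤ |β| := by
        rw [abs_mul, abs_of_pos (Real.exp_pos _)]
        exact mul_le_of_le_one_right (abs_nonneg _) (Real.exp_le_one_iff.2 (by linarith))
      have e2 := abs_sub_abs_le_abs_sub (α * Real.exp x) (-(β * Real.exp (-x)))
      rw [abs_neg, sub_neg_eq_add, abs_mul, abs_of_pos (Real.exp_pos x)] at e2
      linarith
    rw [div_lt_iff₀ hα'] at hx
    nlinarith [Real.add_one_le_exp x]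
  have hα := key α β hsum
  have hβ := key β α fun x => by
    have := hsum (-x)
    rwa [neg_neg, add_comm] at this
  obtain ⟨t, ht⟩ := hne
  apply ht
  rw [hs, hα, hβ]; simp

lemma exists_eq_axis_of_slope_eq_zero {g : ℝ → ℍ} (hg : IsGeodesicLine g) (M : SL(2, ℝ))
    (h : ∀ t, slope (M • g t) = 0) : ∃ e c : ℝ, e ≠ 0 ∧ ∀ t, M • g t = axis (e * t + c) := by
  obtain ⟨w, hw, hd⟩ := hg
  set f := fun t => axialCoord (M • g t) with hf
  have hMg : ∀ t, M • g t = axis (f t) := fun t => eq_axis_of_slope_eq_zero (h t)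
  have hfd : ∀ s t, |f s - f t| = w * |s - t| := fun s t => by
    rw [← dist_axis, ← hMg, ← hMg, dist_smul, hd]
  have hsq : ∀ s t, (f s - f t) ^ 2 = w ^ 2 * (s - t) ^ 2 := fun s t => by
    rw [← sq_abs, hfd, mul_pow, sq_abs]
  have h10 := hsq 1 0
  have he : f 1 - f 0 ≠ 0 := fun he => by
    rw [he] at h10; exact hw.ne' (by simpa using h10.symm)
  refine ⟨f 1 - f 0, f 0, he, fun t => ?_⟩
  rw [hMg t]
  congr 1
  have h1 := hsq t 1
  have h0 := hsq t 0
  refine mul_left_cancel₀ he ?_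
  linear_combination (h0 - h1 + (1 - 2 * t) * h10) / 2

/-- A geodesic contained in the line `h` has the same range as `h`. -/
lemma range_eq {g h : ℝ → ℍ} (hg : IsGeodesicLine g) {M : SL(2, ℝ)} {v : ℝ} (hv : 0 < v)
    (hM : ∀ t, M • h t = axis (v * t)) (hs : ∀ t, slope (M • g t) = 0) :
    Set.range g = Set.range h := by
  obtain ⟨e, c, he, hgax⟩ := hg.exists_eq_axis_of_slope_eq_zero M hs
  apply Set.Subset.antisymm
  · rintro _ ⟨t, rfl⟩
    refine ⟨(e * t + c) / v, smul_left_cancel M ?_⟩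
    rw [hM, hgax]; congr 1; field_simp
  · rintro _ ⟨t, rfl⟩
    refine ⟨(v * t - c) / e, smul_left_cancel M ?_⟩
    rw [hM, hgax]; congr 1; field_simp; ring

end IsGeodesicLine

/-! ### Intersections of curves in the plane -/

section PlanarTopology

/-- If `cos` is nonnegative along a path, the path stays in one interval where it is. -/
lemma exists_forall_abs_sub_le_of_cos_nonneg {w : ℝ → ℝ} (hw : Continuous w) {a b : ℝ}
    (h : ∀ t ∈ Set.uIcc a b, 0 ≤ Real.cos (w t)) :
    ∃ k : ℤ, ∀ t ∈ Set.uIcc a b, |w t - 2 * Real.pi * k| ≤ Real.pi / 2 := by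
  have hpi := Real.pi_pos
  have hcos : ∀ (x : ℝ) (k : ℤ), Real.cos (x - 2 * Real.pi * k) = Real.cos x := fun x k => by
    rw [mul_comm]; exact Real.cos_sub_int_mul_two_pi x k
  have hneg : ∀ x : ℝ, Real.pi / 2 < |x| → |x| ≤ Real.pi → Real.cos x < 0 := fun x h1 h2 => by
    rw [← Real.cos_abs]
    exact Real.cos_neg_of_pi_div_two_lt_of_lt h1 (by linarith)
  set k := round (w a / (2 * Real.pi)) with hk
  refine ⟨k, ?_⟩
  have hround : |w a - 2 * Real.pi * k| ≤ Real.pi := by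
    have h1 := abs_sub_round (w a / (2 * Real.pi))
    rw [← hk] at h1
    have h2 : w a - 2 * Real.pi * k = (2 * Real.pi) * (w a / (2 * Real.pi) - k) := by field_simp
    rw [h2, abs_mul, abs_of_pos (by positivity)]
    nlinarith
  have ha : |w a - 2 * Real.pi * k| ≤ Real.pi / 2 := by
    by_contra! hc
    have := hneg _ hc hround
    rw [hcos] at this
    exact absurd (h a Set.left_mem_uIcc) (not_le.2 this)
  intro t ht
  by_contra! hc
  have hpre : (w '' Set.uIcc a b).OrdConnected :=
    (isPreconnected_uIcc.image w hw.continuousOn).ordConnected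
  have hwa : w a ∈ w '' Set.uIcc a b := ⟨a, Set.left_mem_uIcc, rfl⟩
  have hwt : w t ∈ w '' Set.uIcc a b := ⟨t, ht, rfl⟩
  have hbad : ∀ y ∈ w '' Set.uIcc a b, Real.pi / 2 < |y - 2 * Real.pi * k| →
      |y - 2 * Real.pi * k| ≤ Real.pi → False := by
    rintro _ ⟨s, hs, rfl⟩ h1 h2
    have := hneg _ h1 h2
    rw [hcos] at this
    exact absurd (h s hs) (not_le.2 this)
  rcases le_or_gt |w t - 2 * Real.pi * k| Real.pi with h3 | h3
  · exact hbad _ hwt hc h3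
  · rw [abs_le] at ha
    rcases lt_abs.1 h3 with h4 | h4
    · refine hbad (2 * Real.pi * k + Real.pi) (hpre.out hwa hwt ⟨by linarith, by linarith⟩) ?_ ?_ <;>
        rw [add_sub_cancel_left, abs_of_pos hpi]
      linarith
    · refine hbad (2 * Real.pi * k - Real.pi) (hpre.out hwt hwa ⟨by linarith, by linarith⟩) ?_ ?_ <;>
        rw [sub_sub_cancel_left, abs_neg, abs_of_pos hpi]
      linarith

/-- A form of the Poincaré–Miranda theorem in the plane. -/
lemma exists_eq_zero_of_boundary_signs {F : ℝ × ℝ → ℂ} (hF : Continuous F) {a b c d : ℝ}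
    (ha : ∀ t ∈ Set.uIcc c d, (F (a, t)).re ≤ 0) (hb : ∀ t ∈ Set.uIcc c d, 0 ≤ (F (b, t)).re)
    (hc : ∀ s ∈ Set.uIcc a b, (F (s, c)).im ≤ 0) (hd : ∀ s ∈ Set.uIcc a b, 0 ≤ (F (s, d)).im) :
    ∃ p, F p = 0 := by
  by_contra! hne
  have hpi := Real.pi_pos
  -- A nowhere vanishing `F` has a continuous logarithm, whose imaginary part `v` is a global
  -- argument of `F`. On each side of the rectangle `v` stays within `π / 2` of a fixed centre.
  obtain ⟨L, ⟨-, hL⟩, -⟩ := Complex.isCoveringMapOn_exp.existsUnique_continuousMap_lifts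
    (⟨F, hF⟩ : C(ℝ × ℝ, ℂ)) (a₀ := (0, 0)) (e₀ := Complex.log (F (0, 0)))
    (Complex.exp_log (hne _)) (fun p => hne p)
  have hL' : ∀ p, Complex.exp (L p) = F p := fun p => congrFun hL p
  set v : ℝ × ℝ → ℝ := fun p => (L p).im with hv
  have hvc : Continuous v := Complex.continuous_im.comp L.continuous
  have hre : ∀ p, (F p).re = Real.exp (L p).re * Real.cos (v p) := fun p => by
    rw [← hL', Complex.exp_re]
  have him : ∀ p, (F p).im = Real.exp (L p).re * Real.sin (v p) := fun p => by
    rw [← hL', Complex.exp_im]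
  have hpos : ∀ p, 0 < Real.exp (L p).re := fun p => Real.exp_pos _
  obtain ⟨kR, hR⟩ := exists_forall_abs_sub_le_of_cos_nonneg (w := fun t => v (b, t))
    (by fun_prop) (a := c) (b := d) fun t ht =>
      nonneg_of_mul_nonneg_right ((hre _).symm ▸ hb t ht) (hpos _)
  obtain ⟨kL, hLe⟩ := exists_forall_abs_sub_le_of_cos_nonneg (w := fun t => v (a, t) - Real.pi)
    (by fun_prop) (a := c) (b := d) fun t ht => by
      rw [Real.cos_sub_pi, neg_nonneg]
      exact nonpos_of_mul_nonpos_right ((hre _).symm ▸ ha t ht) (hpos _)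
  obtain ⟨kT, hT⟩ := exists_forall_abs_sub_le_of_cos_nonneg (w := fun s => v (s, d) - Real.pi / 2)
    (by fun_prop) (a := a) (b := b) fun s hs => by
      rw [Real.cos_sub_pi_div_two]
      exact nonneg_of_mul_nonneg_right ((him _).symm ▸ hd s hs) (hpos _)
  obtain ⟨kB, hB⟩ := exists_forall_abs_sub_le_of_cos_nonneg (w := fun s => v (s, c) + Real.pi / 2)
    (by fun_prop) (a := a) (b := b) fun s hs => by
      rw [Real.cos_add_pi_div_two, neg_nonneg]
      exact nonpos_of_mul_nonpos_right ((him _).symm ▸ hc s hs) (hpos _)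
  have hint : ∀ {m n : ℤ}, 2 * Real.pi * m < 2 * Real.pi * n + 2 * Real.pi → m ≤ n := by
    intro m n h
    have h1 : (m : ℝ) < n + 1 := by
      have : 2 * Real.pi * m < 2 * Real.pi * (n + 1) := by linarith
      exact lt_of_mul_lt_mul_left this (by positivity)
    exact Int.lt_add_one_iff.1 (by exact_mod_cast h1)
  have e1 := abs_le.1 (hR d Set.right_mem_uIcc)
  have e2 := abs_le.1 (hT b Set.right_mem_uIcc)
  have e3 := abs_le.1 (hT a Set.left_mem_uIcc)
  have e4 := abs_le.1 (hLe d Set.right_mem_uIcc)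
  have e5 := abs_le.1 (hLe c Set.left_mem_uIcc)
  have e6 := abs_le.1 (hB a Set.left_mem_uIcc)
  have e7 := abs_le.1 (hB b Set.right_mem_uIcc)
  have e8 := abs_le.1 (hR c Set.left_mem_uIcc)
  -- Adjacent sides share a corner, so their centres differ by at most `π`. Going once around makes
  -- the argument gain a full turn, which is impossible for the single-valued `v`.
  have i1 : kR ≤ kT := hint (by linarith)
  have i2 : kT ≤ kL := hint (by linarith)
  have i3 : kL + 1 ≤ kB := hint (by push_cast; linarith)
  have i4 : kB ≤ kR := hint (by linarith)
  omega

/-- Two paths in the plane, one going from far left to far right in a horizontal strip, the other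
from far below to far above in a vertical strip, meet. -/
lemma exists_crossing {x₁ y₁ x₂ y₂ : ℝ → ℝ} (hx₁ : Continuous x₁) (hy₁ : Continuous y₁)
    (hx₂ : Continuous x₂) (hy₂ : Continuous y₂) {B : ℝ} (hB₁ : ∀ s, |y₁ s| ≤ B)
    (hB₂ : ∀ t, |x₂ t| ≤ B) (h₁ : ∃ s, B < x₁ s) (h₁' : ∃ s, x₁ s < -B)
    (h₂ : ∃ t, B < y₂ t) (h₂' : ∃ t, y₂ t < -B) : ∃ s t, x₁ s = x₂ t ∧ y₁ s = y₂ t := by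
  obtain ⟨b, hb⟩ := h₁
  obtain ⟨a, ha⟩ := h₁'
  obtain ⟨c, hc⟩ := h₂
  obtain ⟨d, hd⟩ := h₂'
  obtain ⟨⟨s, t⟩, hst⟩ := exists_eq_zero_of_boundary_signs
    (F := fun p : ℝ × ℝ => ⟨x₁ p.1 - x₂ p.2, y₁ p.1 - y₂ p.2⟩) (a := a) (b := b) (c := c) (d := d)
    (by
      have : (fun p : ℝ × ℝ => (⟨x₁ p.1 - x₂ p.2, y₁ p.1 - y₂ p.2⟩ : ℂ)) =
          fun p => ((x₁ p.1 - x₂ p.2 : ℝ) : ℂ) + ((y₁ p.1 - y₂ p.2 : ℝ) : ℂ) * Complex.I := by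
        ext p; exact Complex.mk_eq_add_mul_I _ _
      rw [this]; fun_prop)
    (fun t _ => by have := abs_le.1 (hB₂ t); simp only; linarith)
    (fun t _ => by have := abs_le.1 (hB₂ t); simp only; linarith)
    (fun s _ => by have := abs_le.1 (hB₁ s); simp only; linarith)
    (fun s _ => by have := abs_le.1 (hB₁ s); simp only; linarith)
  have h1 := congrArg Complex.re hst
  have h2 := congrArg Complex.im hst
  simp only [Complex.zero_re, Complex.zero_im] at h1 h2
  exact ⟨s, t, by linarith, by linarith⟩

/-- A curve in the plane invariant under a horizontal translation meets all its horizontal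
translates. -/
lemma exists_eq_add_of_periodic {x y : ℝ → ℝ} (hx : Continuous x) (hy : Continuous y) {p : ℝ}
    (hp : p ≠ 0) (hxp : ∀ t, x (t + 1) = x t + p) (hyp : ∀ t, y (t + 1) = y t) (l : ℝ) :
    ∃ s t, y s = y t ∧ x s = x t + l := by
  have hper : Function.Periodic y 1 := hyp
  have hK : (Set.Icc (0 : ℝ) 1).Nonempty := ⟨0, by simp⟩
  obtain ⟨b, -, hb⟩ := isCompact_Icc.exists_isMaxOn hK hy.continuousOn
  obtain ⟨a, -, ha⟩ := isCompact_Icc.exists_isMinOn hK hy.continuousOn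
  have hb' : ∀ t, y t ≤ y b := fun t => by
    obtain ⟨s, hs, hst⟩ := hper.exists_mem_Ico₀ one_pos t
    rw [hst]; exact hb (Set.Ico_subset_Icc_self hs)
  have ha' : ∀ t, y a ≤ y t := fun t => by
    obtain ⟨s, hs, hst⟩ := hper.exists_mem_Ico₀ one_pos t
    rw [hst]; exact ha (Set.Ico_subset_Icc_self hs)
  obtain ⟨m, hm⟩ := (isCompact_uIcc (a := a) (b := b)).bddBelow_image hx.continuousOn
  obtain ⟨M, hM⟩ := (isCompact_uIcc (a := a) (b := b)).bddAbove_image hx.continuousOn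
  have hxn : ∀ n : ℤ, x n = x 0 + n * p := fun n => by
    have : Function.Periodic (fun t => x t - t * p) 1 := fun t => by
      simp only [hxp]; ring
    have := this.int_mul n 0
    simp at this
    linarith
  have hsurj : ∀ B : ℝ, (∃ n : ℤ, B ≤ n * p) ∧ ∃ n : ℤ, n * p ≤ B := by
    intro B
    obtain ⟨k, hk⟩ := exists_nat_ge (|B| / |p|)
    rw [div_le_iff₀ (abs_pos.2 hp)] at hk
    have hB := abs_le.1 hk
    rcases lt_or_gt_of_ne hp with h | h
    · rw [abs_of_neg h] at hB
      exact ⟨⟨-k, by push_cast; linarith⟩, ⟨k, by push_cast; linarith⟩⟩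
    · rw [abs_of_pos h] at hB
      exact ⟨⟨k, by push_cast; linarith⟩, ⟨-k, by push_cast; linarith⟩⟩
  obtain ⟨d, hd⟩ := (hsurj (m - x 0 - l)).2
  obtain ⟨c, hc⟩ := (hsurj (M - x 0 - l)).1
  -- The sign of the first component is fixed at the minimum `a` and the maximum `b` of `y`. That of
  -- the second is fixed at integers `c` and `d`, where `x` has drifted beyond its values between
  -- `a` and `b`.
  obtain ⟨⟨s, t⟩, hst⟩ := exists_eq_zero_of_boundary_signs
    (F := fun q : ℝ × ℝ => ⟨y q.1 - y q.2, x q.1 - x q.2 - l⟩) (a := a) (b := b) (c := c) (d := d)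
    (by
      have : (fun q : ℝ × ℝ => (⟨y q.1 - y q.2, x q.1 - x q.2 - l⟩ : ℂ)) =
          fun q => ((y q.1 - y q.2 : ℝ) : ℂ) + ((x q.1 - x q.2 - l : ℝ) : ℂ) * Complex.I := by
        ext p; exact Complex.mk_eq_add_mul_I _ _
      rw [this]; fun_prop)
    (fun t _ => by simp only; linarith [ha' t])
    (fun t _ => by simp only; linarith [hb' t])
    (fun s hs => by have := hM ⟨s, hs, rfl⟩; simp only [hxn]; linarith)
    (fun s hs => by have := hm ⟨s, hs, rfl⟩; simp only [hxn]; linarith)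
  have h1 := congrArg Complex.re hst
  have h2 := congrArg Complex.im hst
  simp only [Complex.zero_re, Complex.zero_im] at h1 h2
  exact ⟨s, t, by linarith, by linarith⟩

end PlanarTopology

/-! ### Deck transformations, lifts and change of marking -/

namespace MarkedHyperbolicStructure

variable {S : Type*} [TopologicalSpace S] (X : MarkedHyperbolicStructure S)

/-- `A` acts on `ℍ` by a deck transformation. -/
def IsDeck (A : SL(2, ℝ)) : Prop := ∀ u : ℍ, X.proj (A • u) = X.proj u

/-- `g` is a continuous lift of the closed curve `c`. -/
def IsLift (c : ClosedCurve S) (g : ℝ → ℍ) : Prop :=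
  Continuous g ∧ ∀ t : ℝ, X.proj (g t) = c (t : UnitAddCircle)

variable {X}

lemma IsDeck.mul {A B : SL(2, ℝ)} (hA : X.IsDeck A) (hB : X.IsDeck B) : X.IsDeck (A * B) :=
  fun u => by rw [mul_smul, hA, hB]

lemma IsDeck.inv {A : SL(2, ℝ)} (hA : X.IsDeck A) : X.IsDeck A⁻¹ :=
  fun u => by rw [← hA, smul_inv_smul]

/-- Two lifts of the same map that agree somewhere are equal. -/
lemma eq_of_proj_eq {T : Type*} [TopologicalSpace T] [PreconnectedSpace T] {f g : T → ℍ}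
    (hf : Continuous f) (hg : Continuous g) (h : ∀ t, X.proj (f t) = X.proj (g t)) {t₀ : T}
    (h₀ : f t₀ = g t₀) (t : T) : f t = g t :=
  congrFun (X.isCoveringMap.eq_of_comp_eq hf hg (funext h) t₀ h₀) t

lemma IsDeck.smul_eq_self {A : SL(2, ℝ)} (hA : X.IsDeck A) {z : ℍ} (hz : A • z = z) (w : ℍ) :
    A • w = w :=
  eq_of_proj_eq (continuous_const_smul A) continuous_id (fun u => hA u) hz w

namespace IsLift

variable {c c' : ClosedCurve S} {g g' : ℝ → ℍ}

lemma eq (hg : X.IsLift c g) (hg' : X.IsLift c g') {t₀ : ℝ} (h : g t₀ = g' t₀) : g = g' :=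
  funext (eq_of_proj_eq hg.1 hg'.1 (fun t => (hg.2 t).trans (hg'.2 t).symm) h)

lemma smul (hg : X.IsLift c g) {A : SL(2, ℝ)} (hA : X.IsDeck A) :
    X.IsLift c fun t => A • g t :=
  ⟨hg.1.const_smul A, fun t => by rw [hA, hg.2]⟩

lemma comp_add_int (hg : X.IsLift c g) (m : ℤ) : X.IsLift c fun t => g (t + m) :=
  ⟨hg.1.comp (continuous_id.add continuous_const), fun t => by
    rw [hg.2]
    congr 1
    rw [AddCircle.coe_add, add_eq_left, AddCircle.coe_eq_zero_iff]
    exact ⟨m, by simp⟩⟩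

lemma exists_deck_of_eq (hg : X.IsLift c g) (hg' : X.IsLift c g') {t₀ : ℝ} :
    ∃ A, X.IsDeck A ∧ A • g t₀ = g' t₀ ∧ ∀ t, g' t = A • g t := by
  obtain ⟨A, hA, hdeck⟩ := X.fiber (g t₀) (g' t₀) ((hg.2 t₀).trans (hg'.2 t₀).symm)
  exact ⟨A, hdeck, hA, fun t => (congrFun ((hg.smul hdeck).eq hg' hA) t).symm⟩

lemma exists_deck (hg : X.IsLift c g) (hg' : X.IsLift c g') :
    ∃ A, X.IsDeck A ∧ ∀ t, g' t = A • g t := by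
  obtain ⟨A, h, -, h'⟩ := hg.exists_deck_of_eq hg' (t₀ := 0)
  exact ⟨A, h, h'⟩

lemma exists_deck_add_int (hg : X.IsLift c g) (m : ℤ) :
    ∃ A, X.IsDeck A ∧ ∀ t, g (t + m) = A • g t :=
  hg.exists_deck (hg.comp_add_int m)

lemma isGeodesicLift (hg : X.IsLift c g) (hc : X.IsClosedGeodesic c) : X.IsGeodesicLift c g := by
  obtain ⟨h, hh, hh'⟩ := hc
  obtain ⟨A, -, hA⟩ := exists_deck ⟨hh.continuous, hh'⟩ hg
  refine ⟨?_, hg.2⟩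
  rw [funext hA]
  exact hh.smul A

/-- Lifting a free homotopy. -/
lemma exists_lift_of_homotopic (hg : X.IsLift c g) (h : c.Homotopic c') :
    ∃ g', X.IsLift c' g' ∧ (∃ K, ∀ t, dist (g t) (g' t) ≤ K) ∧
      ∀ (m : ℤ) (A), X.IsDeck A → (∀ t, g (t + m) = A • g t) → ∀ t, g' (t + m) = A • g' t := by
  obtain ⟨H⟩ := h
  let q : C(ℝ, UnitAddCircle) := ⟨fun t => (t : UnitAddCircle), AddCircle.continuous_mk' 1⟩
  let H' : C(unitInterval × ℝ, S) := H.toContinuousMap.comp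
    ((ContinuousMap.id unitInterval).prodMap q)
  have hH' : ∀ p, H' p = H (p.1, (p.2 : UnitAddCircle)) := fun p => rfl
  have h0 : ∀ t, H' (0, t) = X.proj ((⟨g, hg.1⟩ : C(ℝ, ℍ)) t) := fun t => by
    exact (H.apply_zero _).trans (hg.2 t).symm
  let G := X.isCoveringMap.liftHomotopy H' ⟨g, hg.1⟩ h0
  have hG : ∀ p, X.proj (G p) = H' p :=
    fun p => congrFun (X.isCoveringMap.liftHomotopy_lifts H' ⟨g, hg.1⟩ h0) p
  have hG0 : ∀ t, G (0, t) = g t := X.isCoveringMap.liftHomotopy_zero H' ⟨g, hg.1⟩ h0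
  -- Both sides lift the same map on the strip and agree at `(0, 0)`, so the whole lifted homotopy
  -- is equivariant.
  have hshift : ∀ (m : ℤ) (A), X.IsDeck A → (∀ t, g (t + m) = A • g t) →
      ∀ p : unitInterval × ℝ, G (p.1, p.2 + m) = A • G p := by
    intro m A hA hgA p
    refine eq_of_proj_eq (X := X) (f := fun p : unitInterval × ℝ => G (p.1, p.2 + m))
      (g := fun p => A • G p) (by fun_prop) (G.continuous.const_smul A) (fun p => ?_)
      (t₀ := (0, 0)) ?_ p
    · rw [hG, hA, hG, hH', hH']
      congr 2
      rw [AddCircle.coe_add, add_eq_left, AddCircle.coe_eq_zero_iff]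
      exact ⟨m, by simp⟩
    · simp only [hG0, hgA]
  refine ⟨fun t => G (1, t), ⟨by fun_prop, fun t => ?_⟩, ?_, 
    fun m A hA hgA t => hshift m A hA hgA (1, t)⟩
  · rw [hG, hH', H.apply_one]
  · obtain ⟨A, hA, hgA⟩ := hg.exists_deck_add_int 1
    -- Equivariance under the deck isometry `A` makes the distance periodic; a bound on one period
    -- then suffices.
    have hper : Function.Periodic (fun t => dist (g t) (G (1, t))) 1 := fun t => by
      have h1 := hgA t
      have h2 := hshift 1 A hA hgA (1, t)
      simp only [Int.cast_one] at h1 h2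
      simp only
      rw [h1, h2, dist_smul]
    have hcont : Continuous fun t => dist (g t) (G (1, t)) := hg.1.dist (by fun_prop)
    obtain ⟨K, hK⟩ := (isCompact_Icc (a := (0 : ℝ)) (b := 1)).bddAbove_image hcont.continuousOn
    refine ⟨K, fun t => ?_⟩
    obtain ⟨s, hs, hst⟩ := hper.exists_mem_Ico₀ one_pos t
    exact hst.le.trans (hK ⟨s, Set.Ico_subset_Icc_self hs, rfl⟩)

end IsLift

lemma IsGeodesicLift.isLift {c : ClosedCurve S} {g : ℝ → ℍ} (hg : X.IsGeodesicLift c g) :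
    X.IsLift c g := ⟨hg.1.continuous, hg.2⟩

lemma IsGeodesicLift.smul {c : ClosedCurve S} {g : ℝ → ℍ} (hg : X.IsGeodesicLift c g)
    {A : SL(2, ℝ)} (hA : X.IsDeck A) : X.IsGeodesicLift c fun t => A • g t :=
  ⟨hg.1.smul A, (hg.isLift.smul hA).2⟩

lemma IsGeodesicLift.comp_add_int {c : ClosedCurve S} {g : ℝ → ℍ} (hg : X.IsGeodesicLift c g)
    (m : ℤ) : X.IsGeodesicLift c fun t => g (t + m) :=
  ⟨hg.1.comp_add m, (hg.isLift.comp_add_int m).2⟩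

lemma finite_fiber_inter_closedBall [T1Space S] (x : S) (z : ℍ) (r : ℝ) :
    (X.proj ⁻¹' {x} ∩ Metric.closedBall z r).Finite := by
  have hd : DiscreteTopology (X.proj ⁻¹' {x}) := (X.isCoveringMap x).discreteTopology_fiber
  have hclosed : IsClosed (X.proj ⁻¹' {x}) :=
    isClosed_singleton.preimage X.isCoveringMap.continuous
  have hD : IsDiscrete (X.proj ⁻¹' {x}) := ⟨hd⟩
  exact ((isCompact_closedBall z r).inter_left hclosed).finite (hD.mono Set.inter_subset_left)

lemma exists_closedBall_surjOn [CompactSpace S] (X : MarkedHyperbolicStructure S) :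
    ∃ R : ℝ, ∀ z : ℍ, ∃ A, X.IsDeck A ∧ A • z ∈ Metric.closedBall UpperHalfPlane.I R := by
  obtain ⟨n, hn⟩ := isCompact_univ.elim_directed_cover
    (fun n : ℕ => X.proj '' Metric.ball UpperHalfPlane.I n)
    (fun n => X.isCoveringMap.isOpenMap _ Metric.isOpen_ball)
    (fun x _ => by
      obtain ⟨z, rfl⟩ := X.surjective x
      obtain ⟨n, hn⟩ := exists_nat_gt (dist z UpperHalfPlane.I)
      exact Set.mem_iUnion.2 ⟨n, z, hn, rfl⟩)
    (Monotone.directed_le fun m n hmn =>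
      Set.image_mono (Metric.ball_subset_ball (by exact_mod_cast hmn)))
  refine ⟨n, fun z => ?_⟩
  obtain ⟨w, hw, hwz⟩ := hn (Set.mem_univ (X.proj z))
  obtain ⟨A, hA, hdeck⟩ := X.fiber z w hwz.symm
  exact ⟨A, hdeck, hA ▸ Metric.ball_subset_closedBall hw⟩

variable {Y : MarkedHyperbolicStructure S}

lemma exists_lift_proj (X Y : MarkedHyperbolicStructure S) {z w : ℍ} (h : Y.proj w = X.proj z) :
    ∃ φ : C(ℍ, ℍ), φ z = w ∧ ∀ u, Y.proj (φ u) = X.proj u := by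
  obtain ⟨φ, ⟨h1, h2⟩, -⟩ := Y.isCoveringMap.existsUnique_continuousMap_lifts
    (⟨X.proj, X.isCoveringMap.continuous⟩ : C(ℍ, S)) z w h
  exact ⟨φ, h1, fun u => congrFun h2 u⟩

/-- The change of marking between two hyperbolic structures. -/
lemma exists_homeomorph (X Y : MarkedHyperbolicStructure S) :
    ∃ φ : ℍ ≃ₜ ℍ, ∀ z, Y.proj (φ z) = X.proj z := by
  obtain ⟨w, hw⟩ := Y.surjective (X.proj UpperHalfPlane.I)
  obtain ⟨φ, h1, h2⟩ := exists_lift_proj X Y hw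
  obtain ⟨ψ, h3, h4⟩ := exists_lift_proj Y X hw.symm
  refine ⟨⟨⟨φ, ψ, fun z => ?_, fun z => ?_⟩, φ.continuous, ψ.continuous⟩, h2⟩
  · exact eq_of_proj_eq (X := X) (f := ψ ∘ φ) (g := id) (by fun_prop) continuous_id
      (fun u => by simp [h4, h2]) (t₀ := UpperHalfPlane.I) (by simp [h1, h3]) z
  · exact eq_of_proj_eq (X := Y) (f := φ ∘ ψ) (g := id) (by fun_prop) continuous_id
      (fun u => by simp [h4, h2]) (t₀ := w) (by simp [h1, h3]) z

lemma IsDeck.exists_conj {φ : ℍ ≃ₜ ℍ} (hφ : ∀ z, Y.proj (φ z) = X.proj z) {A : SL(2, ℝ)}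
    (hA : X.IsDeck A) : ∃ B, Y.IsDeck B ∧ ∀ z, φ (A • z) = B • φ z := by
  obtain ⟨B, hB, hdeck⟩ := Y.fiber (φ UpperHalfPlane.I) (φ (A • UpperHalfPlane.I))
    (by rw [hφ, hφ, hA])
  refine ⟨B, hdeck, fun z => ?_⟩
  exact eq_of_proj_eq (X := Y) (f := fun z => φ (A • z)) (g := fun z => B • φ z)
    (φ.continuous.comp (continuous_const_smul A)) (φ.continuous.const_smul B)
    (fun z => by rw [hφ, hA, hdeck, hφ]) hB.symm z

/-- By cocompactness a deck transformation brings `z` into a fixed ball, and `w` into a larger one.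
The images of these balls under `φ` are bounded, and the conjugate `B` is an isometry. -/
lemma exists_dist_le [CompactSpace S] {φ : ℍ ≃ₜ ℍ} (hφ : ∀ z, Y.proj (φ z) = X.proj z) (R : ℝ) :
    ∃ R', ∀ z w, dist z w ≤ R → dist (φ z) (φ w) ≤ R' := by
  obtain ⟨r, hr⟩ := exists_closedBall_surjOn X
  obtain ⟨R', hR'⟩ := ((isCompact_closedBall UpperHalfPlane.I (r + R)).image
    φ.continuous).isBounded.subset_closedBall (φ UpperHalfPlane.I)
  refine ⟨R' + R', fun z w h => ?_⟩
  obtain ⟨A, hA, hz⟩ := hr z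
  obtain ⟨B, -, hB⟩ := hA.exists_conj hφ
  rw [Metric.mem_closedBall] at hz
  have hR : 0 ≤ R := dist_nonneg.trans h
  have hw : dist (A • w) UpperHalfPlane.I ≤ r + R := by
    have := dist_triangle (A • w) (A • z) UpperHalfPlane.I
    rw [dist_smul, dist_comm w z] at this
    linarith
  have h1 := hR' ⟨A • z, Metric.mem_closedBall.2 (by linarith), rfl⟩
  have h2 := hR' ⟨A • w, Metric.mem_closedBall.2 hw, rfl⟩
  rw [Metric.mem_closedBall] at h1 h2
  rw [← dist_smul B, ← hB, ← hB]
  exact (dist_triangle_right _ _ (φ UpperHalfPlane.I)).trans (add_le_add h1 h2)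

end MarkedHyperbolicStructure

/-! ### Geodesics in the classes of disjoint simple curves -/

namespace UpperHalfPlane

lemma exists_abs_slope_le (K : ℝ) : ∃ B, ∀ z u, dist z (axis u) ≤ K → |slope z| ≤ B := by
  refine ⟨Real.cosh K, fun z u h => (abs_slope_le_cosh_dist (w := axis u) (by simp)).trans ?_⟩
  exact Real.cosh_le_cosh.2 (by rw [abs_of_nonneg dist_nonneg]; exact h.trans (le_abs_self K))

/-- Comparing the heights of the images of `axis 0` and `axis (log 2)` gives `P 1 0 = 0`, and then
`P 0 1 = 0`. So `P` acts as the dilation `z ↦ exp l * z`. -/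
lemma slope_axialCoord_smul_of_translation {P : SL(2, ℝ)} {l : ℝ}
    (h : ∀ u, P • axis u = axis (u + l)) (z : ℍ) :
    slope (P • z) = slope z ∧ axialCoord (P • z) = axialCoord z + l := by
  have hdet : P 0 0 * P 1 1 - P 0 1 * P 1 0 = 1 := by
    rw [← Matrix.det_fin_two]; exact P.2
  have hs : ∀ u, P 0 0 * P 1 0 * Real.exp u + P 0 1 * P 1 1 * Real.exp (-u) = 0 := fun u => by
    rw [← slope_smul_axis, h, slope_axis]
  have him : ∀ u, Real.exp (u + l) * (P 1 1 ^ 2 + P 1 0 ^ 2 * Real.exp u ^ 2) = Real.exp u :=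
    fun u => by
    obtain ⟨N, hN, hN', h1, -⟩ := re_im_smul P (axis u)
    rw [h] at h1
    simp only [axis_re, axis_im, mul_zero, zero_add] at h1 hN'
    rw [eq_div_iff hN.ne', hN'] at h1
    linear_combination h1
  have s0 := hs 0
  have s1 := hs (Real.log 2)
  have i0 := him 0
  have i1 := him (Real.log 2)
  rw [Real.exp_neg, Real.exp_log two_pos] at s1
  rw [Real.exp_add, Real.exp_log two_pos] at i1
  simp only [neg_zero, Real.exp_zero, mul_one, zero_add, one_pow] at s0 i0
  have hc : P 1 0 = 0 := by
    have hl := Real.exp_pos l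
    have : Real.exp l * P 1 0 ^ 2 = 0 := by linarith
    rcases mul_eq_zero.1 this with h | h
    · exact absurd h hl.ne'
    · simpa using h
  rw [hc] at hdet i0 s0
  simp only [mul_zero, sub_zero, zero_add] at hdet s0
  have hd : P 1 1 ≠ 0 := right_ne_zero_of_mul (hdet ▸ one_ne_zero)
  have hb : P 0 1 = 0 := (mul_eq_zero.1 s0).resolve_right hd
  refine ⟨?_, ?_⟩
  · rw [slope_smul, hc, hb, hdet, slope]; simp
  · obtain ⟨N, hN, hN', h1, h2⟩ := re_im_smul P z
    have hNl : N = Real.exp (-l) := by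
      rw [hN', hc, Real.exp_neg, eq_comm, inv_eq_iff_eq_inv, eq_comm, inv_eq_iff_eq_inv, eq_comm,
        ← eq_inv_of_mul_eq_one_right i0]
      ring
    have e1 : ((P • z : ℍ) : ℂ) = ((Real.exp l : ℝ) : ℂ) * z := by
      apply Complex.ext
      · rw [Complex.re_ofReal_mul, coe_re, coe_re, h2, hNl, hc, hb, hdet, Real.exp_neg]; simp; ring
      · rw [Complex.im_ofReal_mul, coe_im, coe_im, h1, hNl, Real.exp_neg]; simp; ring
    rw [axialCoord, e1, norm_mul, Complex.norm_real, Real.norm_eq_abs, abs_of_pos (Real.exp_pos l),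
      Real.log_mul (Real.exp_pos l).ne' (norm_coe_pos z).ne', Real.log_exp, axialCoord, add_comm]

end UpperHalfPlane

lemma UnitAddCircle.exists_eq_add_int {x y : ℝ} (h : (x : UnitAddCircle) = y) :
    ∃ m : ℤ, x = y + m := by
  rw [← sub_eq_zero, ← AddCircle.coe_sub, AddCircle.coe_eq_zero_iff] at h
  obtain ⟨m, hm⟩ := h
  exact ⟨m, by rw [zsmul_one] at hm; linarith⟩

namespace MarkedHyperbolicStructure

variable {S : Type*} [TopologicalSpace S] {X : MarkedHyperbolicStructure S}

/-- Lifts of closed geodesics that are homotopic to disjoint simple curves, or to the same simple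
curve, have the same range if they meet. -/
lemma range_eq_of_meet {c₁ c₂ δ₁ δ₂ : ClosedCurve S} {h₁ h₂ : ℝ → ℍ}
    (hh₁ : X.IsGeodesicLift c₁ h₁) (hh₂ : X.IsGeodesicLift c₂ h₂)
    (hc₁ : c₁.Homotopic δ₁) (hc₂ : c₂.Homotopic δ₂)
    (hδ : ∀ x y, δ₁ x = δ₂ y → δ₁ = δ₂ ∧ x = y) {s₀ t₀ : ℝ} (hmeet : h₁ s₀ = h₂ t₀) :
    Set.range h₂ = Set.range h₁ := by
  obtain ⟨M, v, hv, hM⟩ := hh₁.1.exists_smul_eq_axis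
  by_contra hne
  have hex : ∃ t, slope (M • h₂ t) ≠ 0 := by
    by_contra! hall
    exact hne (hh₂.1.range_eq hv hM hall)
  obtain ⟨κ, w, hκ, hw, hκw, C, hC⟩ := hh₂.1.exists_slope_eq_sinh M (t₀ := t₀)
    (by rw [← hmeet, hM, slope_axis]) hex
  obtain ⟨d₁, hd₁, ⟨K₁, hK₁⟩, -⟩ := hh₁.isLift.exists_lift_of_homotopic hc₁
  obtain ⟨d₂, hd₂, ⟨K₂, hK₂⟩, -⟩ := hh₂.isLift.exists_lift_of_homotopic hc₂
  have hD₁ : ∀ s, dist (M • d₁ s) (axis (v * s)) ≤ K₁ := fun s => by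
    rw [← hM, dist_smul, dist_comm]; exact hK₁ s
  have hD₂ : ∀ t, dist (M • h₂ t) (M • d₂ t) ≤ K₂ := fun t => by
    rw [dist_smul]; exact hK₂ t
  obtain ⟨C₁, hC₁⟩ := exists_abs_axialCoord_sub_le K₁
  obtain ⟨C₂, hC₂⟩ := exists_abs_axialCoord_sub_le K₂
  obtain ⟨B₁, hB₁⟩ := exists_abs_slope_le K₁
  set B := max B₁ (C + C₂)
  obtain ⟨R, hR⟩ := UpperHalfPlane.exists_slope_gt K₂ B
  have hsinh : ∀ y, ∃ t, Real.sinh (w * (t - t₀)) = y := fun y =>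
    ⟨Real.arsinh y / w + t₀, by rw [add_sub_cancel_right, mul_div_cancel₀ _ hw.ne',
      Real.sinh_arsinh]⟩
  have hsurj : ∀ y, ∃ t, slope (M • h₂ t) = y := fun y => by
    obtain ⟨t, ht⟩ := hsinh (y / κ)
    exact ⟨t, by rw [hκw, ht, mul_div_cancel₀ _ hκ]⟩
  -- In the coordinates `(axialCoord, slope)` the lift `d₁` follows the axis in a horizontal strip,
  -- while `d₂` follows the transverse `h₂` in a vertical strip.
  obtain ⟨s, t, h1, h2⟩ := exists_crossing (B := B)
    (continuous_axialCoord.comp (hd₁.1.const_smul M)) (continuous_slope.comp (hd₁.1.const_smul M))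
    (continuous_axialCoord.comp (hd₂.1.const_smul M)) (continuous_slope.comp (hd₂.1.const_smul M))
    (fun s => (hB₁ _ _ (hD₁ s)).trans (le_max_left _ _))
    (fun t => by
      have e1 := hC₂ _ _ (hD₂ t)
      have e2 := abs_sub_abs_le_abs_sub (axialCoord (M • d₂ t)) (axialCoord (M • h₂ t))
      rw [abs_sub_comm] at e2
      have e3 : |axialCoord (M • d₂ t)| ≤ C + C₂ := by linarith [hC t]
      exact e3.trans (le_max_right _ _))
    (by
      refine ⟨(B + C₁ + 1) / v, ?_⟩
      have e1 := abs_le.1 (hC₁ _ _ (hD₁ ((B + C₁ + 1) / v)))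
      rw [axialCoord_axis, mul_div_cancel₀ _ hv.ne'] at e1
      simp only [Function.comp, Pi.smul_apply]
      linarith)
    (by
      refine ⟨(-B - C₁ - 1) / v, ?_⟩
      have e1 := abs_le.1 (hC₁ _ _ (hD₁ ((-B - C₁ - 1) / v)))
      rw [axialCoord_axis, mul_div_cancel₀ _ hv.ne'] at e1
      simp only [Function.comp, Pi.smul_apply]
      linarith)
    (by
      obtain ⟨t, ht⟩ := hsurj (R + 1)
      exact ⟨t, (hR _ _ (hD₂ t)).1 (by linarith)⟩)
    (by
      obtain ⟨t, ht⟩ := hsurj (-R - 1)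
      exact ⟨t, (hR _ _ (hD₂ t)).2 (by linarith)⟩)
  have hst : d₁ s = d₂ t := smul_left_cancel M (ext_slope_axialCoord h2 h1)
  obtain ⟨rfl, hxy⟩ := hδ s t (by rw [← hd₁.2, ← hd₂.2, hst])
  obtain ⟨m, rfl⟩ := UnitAddCircle.exists_eq_add_int hxy
  -- Meeting now forces the two simple curves to coincide and `d₁` to be an integer shift of `d₂`.
  -- Hence `h₂` stays near `h₁`, contradicting `exists_slope_gt`.
  have hdd := hd₁.eq (hd₂.comp_add_int (-m)) (t₀ := t + m) (by simpa using hst)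
  obtain ⟨B', hB'⟩ := exists_abs_slope_le (K₁ + K₂)
  obtain ⟨t', ht'⟩ := hh₂.1.exists_slope_gt M hex B'
  refine absurd (hB' (M • h₂ t') (v * (t' + m)) ?_) (not_le.2 ht')
  rw [← hM, dist_smul]
  have e1 := hK₁ (t' + m)
  rw [hdd] at e1
  simp only [Int.cast_neg, add_neg_cancel_right] at e1
  rw [dist_comm] at e1 ⊢
  have := dist_triangle_right (h₁ (t' + m)) (h₂ t') (d₂ t')
  rw [dist_comm] at e1
  linarith [hK₂ t']

/-- A closed geodesic homotopic to a simple curve is primitive: deck transformations translating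
along one of its lifts translate by an integer. -/
lemma exists_int_eq_of_translation {c δ : ClosedCurve S} {h : ℝ → ℍ} (hh : X.IsGeodesicLift c h)
    (hc : c.Homotopic δ) (hδ : δ.IsSimple) {A : SL(2, ℝ)} (hA : X.IsDeck A) {τ : ℝ}
    (hτ : ∀ t, A • h t = h (t + τ)) : ∃ m : ℤ, τ = m := by
  obtain ⟨M, v, hv, hM⟩ := hh.1.exists_smul_eq_axis
  obtain ⟨d, hd, -, hdeck⟩ := hh.isLift.exists_lift_of_homotopic hc
  have htrans : ∀ (A : SL(2, ℝ)) (τ : ℝ), (∀ t, A • h t = h (t + τ)) → ∀ z,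
      slope (M • A • z) = slope (M • z) ∧ axialCoord (M • A • z) = axialCoord (M • z) + v * τ := by
    intro A τ hτ z
    have := slope_axialCoord_smul_of_translation (P := M * A * M⁻¹) (l := v * τ) (fun u => by
      have e1 := hM (u / v)
      rw [mul_div_cancel₀ _ hv.ne'] at e1
      rw [← e1, mul_smul, inv_smul_smul, mul_smul, hτ, hM]
      congr 1; field_simp) (M • z)
    rwa [mul_smul, inv_smul_smul, mul_smul] at this
  obtain ⟨A₁, hA₁, hA₁h⟩ := hh.isLift.exists_deck_add_int 1
  have hA₁d := hdeck 1 A₁ hA₁ hA₁h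
  simp only [Int.cast_one] at hA₁h hA₁d
  -- `A₁` makes `d` periodic in the axial direction, so `d` meets its image under `A`, which is its
  -- translate by `v * τ`. Simplicity then restricts the meeting parameters to differ by an integer.
  obtain ⟨s, t, h1, h2⟩ := exists_eq_add_of_periodic
    (continuous_axialCoord.comp (hd.1.const_smul M)) (continuous_slope.comp (hd.1.const_smul M))
    (p := v) hv.ne'
    (fun t => by
      have := (htrans A₁ 1 (fun t => (hA₁h t).symm) (d t)).2
      simpa [hA₁d] using this)
    (fun t => by
      have := (htrans A₁ 1 (fun t => (hA₁h t).symm) (d t)).1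
      simpa [hA₁d] using this) (v * τ)
  have hst : d s = A • d t := by
    refine smul_left_cancel M (ext_slope_axialCoord ?_ ?_)
    · rw [(htrans A τ hτ _).1]; exact h1
    · rw [(htrans A τ hτ _).2]; exact h2
  obtain ⟨m, rfl⟩ := UnitAddCircle.exists_eq_add_int (x := s) (y := t)
    (hδ (by rw [← hd.2, ← hd.2, hst, hA]))
  obtain ⟨A', hA', hA'h⟩ := hh.isLift.exists_deck_add_int m
  have hfix : (A'⁻¹ * A) • d t = d t := by
    rw [mul_smul, ← hst, hdeck m A' hA' hA'h, inv_smul_smul]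
  have e1 := (hA'.inv.mul hA).smul_eq_self hfix (h 0)
  rw [mul_smul, inv_smul_eq_iff, hτ, ← hA'h] at e1
  have e2 := congrArg (M • ·) e1
  simp only [hM] at e2
  have e3 := axis_injective e2
  refine ⟨m, ?_⟩
  simpa [hv.ne'] using e3

lemma homotopic_comp_add (c : ClosedCurve S) (a : ℝ) :
    c.Homotopic (c.comp ⟨fun x : UnitAddCircle => x + (a : UnitAddCircle), by fun_prop⟩) := by
  obtain ⟨q, hq⟩ : ∃ q : C(ℝ, UnitAddCircle), ∀ t : ℝ, q t = t :=
    ⟨⟨fun t => (t : UnitAddCircle), AddCircle.continuous_mk' 1⟩, fun _ => rfl⟩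
  refine ⟨⟨⟨fun p => c (p.2 + q (p.1 * a)), by fun_prop⟩, fun x => ?_, fun x => ?_⟩⟩
  · simp [hq]
  · simp [hq]

/-- Closed geodesics homotopic to simple curves are homotopic up to orientation if they have lifts
with the same range. -/
lemma homotopic_or_homotopic_reverse {c₁ c₂ δ₁ δ₂ : ClosedCurve S} {h₁ h₂ : ℝ → ℍ}
    (hh₁ : X.IsGeodesicLift c₁ h₁) (hh₂ : X.IsGeodesicLift c₂ h₂)
    (hc₁ : c₁.Homotopic δ₁) (hc₂ : c₂.Homotopic δ₂) (hδ₁ : δ₁.IsSimple) (hδ₂ : δ₂.IsSimple)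
    (hr : Set.range h₂ = Set.range h₁) : c₁.Homotopic c₂ ∨ c₁.reverse.Homotopic c₂ := by
  obtain ⟨M, v, hv, hM⟩ := hh₁.1.exists_smul_eq_axis
  obtain ⟨e', c', he', hM₂⟩ := hh₂.1.exists_eq_axis_of_slope_eq_zero M (fun t => by
    obtain ⟨s, hs⟩ : h₂ t ∈ Set.range h₁ := hr ▸ ⟨t, rfl⟩
    rw [← hs, hM, slope_axis])
  obtain ⟨e, c, he, h12⟩ : ∃ e c : ℝ, e ≠ 0 ∧ ∀ t, h₂ t = h₁ (e * t + c) :=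
    ⟨e' / v, c' / v, div_ne_zero he' hv.ne', fun t => smul_left_cancel M (by
      rw [hM₂, hM]; congr 1; field_simp)⟩
  obtain ⟨A₁, hA₁, hA₁h⟩ := hh₁.isLift.exists_deck_add_int 1
  obtain ⟨A₂, hA₂, hA₂h⟩ := hh₂.isLift.exists_deck_add_int 1
  -- One period of `h₂` translates `h₁` by `e`, and one period of `h₁` translates `h₂` by `1 / e`.
  -- Primitivity of both makes `e` and `1 / e` integers, so `e = ±1`.
  obtain ⟨m, hm⟩ := exists_int_eq_of_translation hh₁ hc₁ hδ₁ hA₂ (τ := e) (fun t => by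
    have := hA₂h ((t - c) / e)
    have e1 : e * ((t - c) / e) + c = t := by rw [mul_div_cancel₀ _ he]; ring
    have e2 : e * ((t - c) / e + (1 : ℤ)) + c = t + e := by
      rw [mul_add, mul_div_cancel₀ _ he]; push_cast; ring
    rw [h12, h12, e1, e2] at this
    exact this.symm)
  obtain ⟨n, hn⟩ := exists_int_eq_of_translation hh₂ hc₂ hδ₂ hA₁ (τ := 1 / e) (fun t => by
    rw [h12, h12, ← hA₁h]
    congr 1; field_simp; push_cast; ring)
  have hmn : m * n = 1 := by
    have : (m : ℝ) * n = 1 := by rw [← hm, ← hn]; field_simp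
    exact_mod_cast this
  have hc : ∀ t : ℝ, c₂ (t : UnitAddCircle) = c₁ ((m * t + c : ℝ) : UnitAddCircle) := fun t => by
    rw [← hh₂.2, ← hh₁.2, h12, hm]
  rcases Int.isUnit_iff.1 (IsUnit.of_mul_eq_one _ hmn) with rfl | rfl
  · left
    have h2 : c₂ = c₁.comp ⟨fun x : UnitAddCircle => x + (c : UnitAddCircle), by fun_prop⟩ := by
      ext x
      induction x using QuotientAddGroup.induction_on with
      | H t => simpa using hc t
    rw [h2]
    exact homotopic_comp_add c₁ c
  · right
    have h2 : c₂ = c₁.reverse.comp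
        ⟨fun x : UnitAddCircle => x + ((-c : ℝ) : UnitAddCircle), by fun_prop⟩ := by
      ext x
      induction x using QuotientAddGroup.induction_on with
      | H t => simpa [ClosedCurve.reverse, add_comm] using hc t
    rw [h2]
    exact homotopic_comp_add c₁.reverse (-c)

end MarkedHyperbolicStructure

/-! ### Sides of a line under a coarse homeomorphism -/

section SignPreservation

lemma IsPreconnected.pos_or_neg {T : Type*} [TopologicalSpace T] {s : Set T}
    (hs : IsPreconnected s) {f : T → ℝ} (hf : Continuous f) (h : ∀ x ∈ s, f x ≠ 0) :
    (∀ x ∈ s, 0 < f x) ∨ ∀ x ∈ s, f x < 0 := by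
  by_contra! hc
  obtain ⟨⟨x, hx, hx'⟩, y, hy, hy'⟩ := hc
  obtain ⟨z, hz, hz'⟩ := hs.intermediate_value hx hy hf.continuousOn ⟨hx', hy'⟩
  exact h z hz hz'

lemma mul_pos_of_forall_ne_zero {f : ℝ → ℝ} (hf : Continuous f) (h : ∀ t, f t ≠ 0) {c s : ℝ}
    (hs : 0 < c * f s) (t : ℝ) : 0 < c * f t := by
  rcases isPreconnected_univ.pos_or_neg hf (fun x _ => h x) with h' | h'
  · exact mul_pos ((pos_iff_pos_of_mul_pos hs).2 (h' s trivial)) (h' t trivial)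
  · exact mul_pos_of_neg_of_neg ((neg_iff_neg_of_mul_pos hs).2 (h' s trivial)) (h' t trivial)

namespace UpperHalfPlane

lemma exists_slope_eq (y : ℝ) : ∃ z : ℍ, slope z = y :=
  ⟨⟨⟨y, 1⟩, one_pos⟩, by simp [slope]⟩

/-- In Euclidean terms the region is an intersection of two half-planes, hence convex. -/
lemma isPreconnected_lt_slope (R : ℝ) : IsPreconnected {z : ℍ | R < slope z} := by
  rw [← isOpenEmbedding_coe.isInducing.isPreconnected_image]
  have : UpperHalfPlane.coe '' {z : ℍ | R < slope z} =
      {z : ℂ | 0 < z.im} ∩ {z : ℂ | 0 < z.re - R * z.im} := by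
    ext z
    constructor
    · rintro ⟨w, hw, rfl⟩
      refine ⟨w.im_pos, ?_⟩
      rw [Set.mem_ofPred_eq, slope, lt_div_iff₀ w.im_pos] at hw
      simpa using hw
    · rintro ⟨h1, h2⟩
      refine ⟨⟨z, h1⟩, ?_, rfl⟩
      rw [Set.mem_ofPred_eq, slope, lt_div_iff₀ (im_pos _)]
      simpa using h2
  rw [this]
  refine ((convex_halfSpace_im_gt 0).inter ?_).isPreconnected
  exact convex_halfSpace_gt (f := fun z : ℂ => z.re - R * z.im)
    ⟨fun x y => by simp; ring, fun c x => by simp; ring⟩ 0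

lemma isPreconnected_slope_lt (R : ℝ) : IsPreconnected {z : ℍ | slope z < R} := by
  rw [← isOpenEmbedding_coe.isInducing.isPreconnected_image]
  have : UpperHalfPlane.coe '' {z : ℍ | slope z < R} =
      {z : ℂ | 0 < z.im} ∩ {z : ℂ | z.re - R * z.im < 0} := by
    ext z
    constructor
    · rintro ⟨w, hw, rfl⟩
      refine ⟨w.im_pos, ?_⟩
      rw [Set.mem_ofPred_eq, slope, div_lt_iff₀ w.im_pos] at hw
      simpa using hw
    · rintro ⟨h1, h2⟩
      refine ⟨⟨z, h1⟩, ?_, rfl⟩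
      rw [Set.mem_ofPred_eq, slope, div_lt_iff₀ (im_pos _)]
      simpa using h2
  rw [this]
  refine ((convex_halfSpace_im_gt 0).inter ?_).isPreconnected
  exact convex_halfSpace_lt (f := fun z : ℂ => z.re - R * z.im)
    ⟨fun x y => by simp; ring, fun c x => by simp; ring⟩ 0

/-- Points at bounded distance have images at bounded distance. -/
def IsCoarse (φ : ℍ → ℍ) : Prop :=
  ∀ R, ∃ R', ∀ z w, dist z w ≤ R → dist (φ z) (φ w) ≤ R'

/-- `φ` takes the curve `g` to a curve at bounded distance from `g'`. -/
def IsClose (φ : ℍ → ℍ) (g g' : ℝ → ℍ) : Prop :=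
  ∃ K, ∀ t, dist (φ (g t)) (g' t) ≤ K

/-- `M` takes `h` to the imaginary axis. -/
def IsFrame (M : SL(2, ℝ)) (h : ℝ → ℍ) : Prop :=
  ∃ v : ℝ, 0 < v ∧ ∀ t, M • h t = axis (v * t)

variable {φ : ℍ ≃ₜ ℍ} {g g' h h' : ℝ → ℍ} {M M' : SL(2, ℝ)}

lemma IsFrame.slope_eq_zero (hM : IsFrame M h) (t : ℝ) : slope (M • h t) = 0 := by
  obtain ⟨v, -, hM⟩ := hM
  rw [hM, slope_axis]

lemma IsFrame.exists_smul_eq_axis (hM : IsFrame M h) (u : ℝ) : ∃ t, M • h t = axis u := by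
  obtain ⟨v, hv, hM⟩ := hM
  exact ⟨u / v, by rw [hM, mul_div_cancel₀ _ hv.ne']⟩

lemma IsFrame.mem_range (hM : IsFrame M h) {z : ℍ} (hz : slope (M • z) = 0) :
    z ∈ Set.range h := by
  obtain ⟨t, ht⟩ := hM.exists_smul_eq_axis (axialCoord (M • z))
  exact ⟨t, smul_left_cancel M (by rw [ht, ← eq_axis_of_slope_eq_zero hz])⟩

lemma IsClose.symm (hφ : IsCoarse φ.symm) (hh : IsClose φ h h') : IsClose φ.symm h' h := by
  obtain ⟨K, hK⟩ := hh
  obtain ⟨K', hK'⟩ := hφ K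
  refine ⟨K', fun t => ?_⟩
  have := hK' _ _ (hK t)
  rwa [φ.symm_apply_apply, dist_comm] at this

/-- If `φ z` were near `h'`, it would be near some `φ (h t)`, and coarseness of the inverse would
put `z` near `h`. -/
lemma exists_lt_abs_slope (hφ : IsCoarse φ.symm) (hh : IsClose φ h h')
    (hM : IsFrame M h) (hM' : IsFrame M' h') (B : ℝ) :
    ∃ R, ∀ z, R < |slope (M • z)| → B < |slope (M' • φ z)| := by
  obtain ⟨K, hK⟩ := hh
  obtain ⟨K', hK'⟩ := hφ (B + 1 + K)
  obtain ⟨R, hR⟩ := exists_abs_slope_le K'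
  refine ⟨R, fun z hz => ?_⟩
  by_contra! hB
  obtain ⟨t, ht⟩ := hM'.exists_smul_eq_axis (axialCoord (M' • φ z))
  have h1 := dist_axis_axialCoord_le (M' • φ z)
  rw [← ht, dist_smul] at h1
  have h2 := dist_triangle_right (φ z) (φ (h t)) (h' t)
  have h3 := hK' (φ z) (φ (h t)) (by linarith [hK t])
  rw [φ.symm_apply_apply, φ.symm_apply_apply, ← dist_smul M] at h3
  obtain ⟨v, -, hMv⟩ := hM
  rw [hMv] at h3
  exact absurd (hR _ _ h3) (not_le.2 hz)

/-- A homeomorphism that is coarse in both directions and takes `h` to a curve close to `h'` takes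
the two sides of `h` to the two sides of `h'`, far from these lines. -/
lemma exists_side (hφ : IsCoarse φ) (hφ' : IsCoarse φ.symm) (hh : IsClose φ h h')
    (hM : IsFrame M h) (hM' : IsFrame M' h') :
    ∃ ε : ℝ, ∀ K, ∃ R, ∀ z w, dist (φ z) w ≤ K →
      (R < slope (M • z) → 0 < ε * slope (M' • w)) ∧
      (slope (M • z) < -R → ε * slope (M' • w) < 0) := by
  obtain ⟨R₀, hR₀⟩ := exists_lt_abs_slope hφ' hh hM hM' 0
  obtain ⟨R₁, hR₁⟩ := exists_lt_abs_slope (φ := φ.symm) hφ (hh.symm hφ') hM' hM R₀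
  have hcont : Continuous fun z : ℍ => slope (M' • φ (M⁻¹ • z)) :=
    continuous_slope.comp ((φ.continuous.comp (continuous_const_smul M⁻¹)).const_smul M')
  have hpos := (isPreconnected_lt_slope R₀).pos_or_neg hcont fun z hz => by
    have := hR₀ (M⁻¹ • z) (by rw [smul_inv_smul]; exact lt_of_lt_of_le hz (le_abs_self _))
    exact abs_pos.1 this
  have hneg := (isPreconnected_slope_lt (-R₀)).pos_or_neg hcont fun z hz => by
    have hz' : R₀ < -slope z := by have : slope z < -R₀ := hz; linarith
    have := hR₀ (M⁻¹ • z) (by rw [smul_inv_smul]; exact lt_of_lt_of_le hz' (neg_le_abs _))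
    exact abs_pos.1 this
  have hpt : ∀ y, R₁ < |y| → ∃ z, R₀ < |slope z| ∧ slope (M' • φ (M⁻¹ • z)) = y := by
    intro y hy
    obtain ⟨w, hw⟩ := exists_slope_eq y
    refine ⟨M • φ.symm (M'⁻¹ • w), hR₁ _ (by rwa [smul_inv_smul, hw]), ?_⟩
    rw [inv_smul_smul, φ.apply_symm_apply, smul_inv_smul, hw]
  -- The two far sides cannot have images on the same side: `φ` is onto, and points far from `h'` on
  -- either side come from points far from `h`.
  have hsame : ∀ c : ℝ, c ≠ 0 →
      ¬((∀ z ∈ {z | R₀ < slope z}, 0 < c * slope (M' • φ (M⁻¹ • z))) ∧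
        ∀ z ∈ {z | slope z < -R₀}, 0 < c * slope (M' • φ (M⁻¹ • z))) := by
    rintro c hc ⟨hp, hn⟩
    obtain ⟨z, hz, hz'⟩ := hpt (-(|R₁| + 1) / c * |c|) (by
      rw [abs_mul, abs_div, abs_abs, div_mul_cancel₀ _ (abs_ne_zero.2 hc), abs_neg,
        abs_of_pos (by positivity)]
      linarith [le_abs_self R₁])
    have hlt : c * slope (M' • φ (M⁻¹ • z)) < 0 := by
      rw [hz']
      have : c * (-(|R₁| + 1) / c * |c|) = -((|R₁| + 1) * |c|) := by field_simp
      rw [this]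
      have := abs_pos.2 hc
      have : 0 < (|R₁| + 1) * |c| := by positivity
      linarith
    rcases lt_abs.1 hz with h | h
    · exact absurd (hp z h) (not_lt.2 hlt.le)
    · exact absurd (hn z (show slope z < -R₀ by linarith)) (not_lt.2 hlt.le)
  obtain ⟨ε, hε, hp, hn⟩ : ∃ ε : ℝ, (ε = 1 ∨ ε = -1) ∧
      (∀ z ∈ {z | R₀ < slope z}, 0 < ε * slope (M' • φ (M⁻¹ • z))) ∧
        ∀ z ∈ {z | slope z < -R₀}, ε * slope (M' • φ (M⁻¹ • z)) < 0 := by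
    rcases hpos with hpos | hpos <;> rcases hneg with hneg | hneg
    · exact absurd ⟨fun z hz => by simpa using hpos z hz, fun z hz => by simpa using hneg z hz⟩
        (hsame 1 one_ne_zero)
    · exact ⟨1, Or.inl rfl, fun z hz => by simpa using hpos z hz,
        fun z hz => by simpa using hneg z hz⟩
    · exact ⟨-1, Or.inr rfl, fun z hz => by simpa using hpos z hz,
        fun z hz => by simpa using hneg z hz⟩
    · exact absurd ⟨fun z hz => by simpa using hpos z hz, fun z hz => by simpa using hneg z hz⟩
        (hsame (-1) (by norm_num))
  refine ⟨ε, fun K => ?_⟩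
  obtain ⟨B, hB⟩ := exists_slope_gt K 0
  obtain ⟨R₂, hR₂⟩ := exists_lt_abs_slope hφ' hh hM hM' B
  refine ⟨max R₀ R₂, fun z w hzw => ?_⟩
  have hd : dist (M' • φ z) (M' • w) ≤ K := by rwa [dist_smul]
  have hB' := hB _ _ hd
  rw [neg_zero] at hB'
  constructor
  · intro hz
    have h1 := hp (M • z) ((le_max_left _ _).trans_lt hz)
    have h2 := hR₂ z (((le_max_right _ _).trans_lt hz).trans_le (le_abs_self _))
    rw [inv_smul_smul] at h1
    rcases hε with rfl | rfl
    · rw [one_mul] at h1 ⊢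
      rw [abs_of_pos h1] at h2
      exact hB'.1 h2
    · have h3 : slope (M' • φ z) < 0 := by linarith
      rw [abs_of_neg h3] at h2
      have := hB'.2 (by linarith)
      linarith
  · intro hz
    have hz' : max R₀ R₂ < -slope (M • z) := by linarith
    have h1 := hn (M • z) (show slope (M • z) < -R₀ by linarith [le_max_left R₀ R₂])
    have h2 := hR₂ z (((le_max_right _ _).trans_lt hz').trans_le (neg_le_abs _))
    rw [inv_smul_smul] at h1
    rcases hε with rfl | rfl
    · rw [one_mul] at h1 ⊢
      rw [abs_of_neg h1] at h2
      exact hB'.2 (by linarith)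
    · have h3 : 0 < slope (M' • φ z) := by linarith
      rw [abs_of_pos h3] at h2
      have := hB'.1 h2
      linarith

end UpperHalfPlane

end SignPreservation

lemma IsGeodesicLine.exists_isFrame {h : ℝ → ℍ} (hh : IsGeodesicLine h) : ∃ M, IsFrame M h :=
  hh.exists_smul_eq_axis

lemma IsGeodesicLine.exists_slope_ne_zero {g h : ℝ → ℍ} (hg : IsGeodesicLine g) {M : SL(2, ℝ)}
    (hM : IsFrame M h) (hne : Set.range g ≠ Set.range h) : ∃ t, slope (M • g t) ≠ 0 := by
  by_contra! hall
  obtain ⟨v, hv, hMv⟩ := hM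
  exact hne (hg.range_eq hv hMv hall)

/-! ### Preservation of crossings and of their order -/

namespace UpperHalfPlane

variable {φ : ℍ ≃ₜ ℍ} {g g' h h' : ℝ → ℍ} {M M' : SL(2, ℝ)}

/-- The sign of `κ` records the direction in which `g` crosses `h`, and `ε` records whether `φ`
exchanges the sides. The ends of `g` lie far on opposite sides, so the ends of `g'` lie on the sides
dictated by `κ * ε`. -/
lemma exists_slope_mul_pos {ε κ w t₀ : ℝ}
    (hε : ∀ K, ∃ R, ∀ z w, dist (φ z) w ≤ K →
      (R < slope (M • z) → 0 < ε * slope (M' • w)) ∧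
      (slope (M • z) < -R → ε * slope (M' • w) < 0))
    (hg : IsClose φ g g') (hκ : κ ≠ 0) (hw : 0 < w)
    (hslope : ∀ t, slope (M • g t) = κ * Real.sinh (w * (t - t₀))) :
    ∃ T, (∀ t, T ≤ t → 0 < κ * ε * slope (M' • g' t)) ∧
      ∀ t, t ≤ -T → κ * ε * slope (M' • g' t) < 0 := by
  obtain ⟨K, hK⟩ := hg
  obtain ⟨R, hR⟩ := hε K
  have hκ' := abs_pos.2 hκ
  set y := (|R| + 1) / |κ| with hy
  have hy0 : 0 < y := by positivity
  have hyR : R < |κ| * y := by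
    rw [hy, mul_div_cancel₀ _ hκ'.ne']
    linarith [le_abs_self R]
  refine ⟨|t₀| + y / w, fun t ht => ?_, fun t ht => ?_⟩
  · have h1 : y ≤ w * (t - t₀) := by
      have : y / w ≤ t - t₀ := by linarith [le_abs_self t₀]
      rw [div_le_iff₀ hw] at this
      linarith
    have h2 := h1.trans (Real.self_le_sinh_iff.2 (hy0.le.trans h1))
    have h3 := mul_le_mul_of_nonneg_left h2 hκ'.le
    rcases lt_or_gt_of_ne hκ with h | h
    · have := (hR _ _ (hK t)).2 (by rw [hslope]; rw [abs_of_neg h] at h3 hyR; linarith)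
      rw [mul_assoc]
      exact mul_pos_of_neg_of_neg h this
    · have := (hR _ _ (hK t)).1 (by rw [hslope]; rw [abs_of_pos h] at h3 hyR; linarith)
      rw [mul_assoc]
      exact mul_pos h this
  · have h1 : y ≤ -(w * (t - t₀)) := by
      have : y / w ≤ -(t - t₀) := by linarith [neg_abs_le t₀]
      rw [div_le_iff₀ hw] at this
      linarith
    have h2 := h1.trans (Real.self_le_sinh_iff.2 (hy0.le.trans h1))
    rw [Real.sinh_neg] at h2
    have h3 := mul_le_mul_of_nonneg_left h2 hκ'.le
    rcases lt_or_gt_of_ne hκ with h | h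
    · have := (hR _ _ (hK t)).1 (by rw [hslope]; rw [abs_of_neg h] at h3 hyR; linarith)
      rw [mul_assoc]
      exact mul_neg_of_neg_of_pos h this
    · have := (hR _ _ (hK t)).2 (by rw [hslope]; rw [abs_of_pos h] at h3 hyR; linarith)
      rw [mul_assoc]
      exact mul_neg_of_pos_of_neg h this

/-- Crossings are preserved. -/
lemma exists_crossing_of_crossing (hφ : IsCoarse φ) (hφ' : IsCoarse φ.symm)
    (hgg' : IsClose φ g g') (hhh' : IsClose φ h h') (hg : IsGeodesicLine g)
    (hg' : IsGeodesicLine g') (hh : IsGeodesicLine h) (hh' : IsGeodesicLine h') {t s : ℝ}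
    (hts : g t = h s) (hne : Set.range g ≠ Set.range h) :
    ∃ t' s', g' t' = h' s' ∧ Set.range g' ≠ Set.range h' := by
  obtain ⟨M, hM⟩ := hh.exists_isFrame
  obtain ⟨M', hM'⟩ := hh'.exists_isFrame
  obtain ⟨ε, hε⟩ := exists_side hφ hφ' hhh' hM hM'
  obtain ⟨κ, w, hκ, hw, hslope, -⟩ := hg.exists_slope_eq_sinh M
    (t₀ := t) (by rw [hts, hM.slope_eq_zero]) (hg.exists_slope_ne_zero hM hne)
  obtain ⟨T, h1, h2⟩ := exists_slope_mul_pos hε hgg' hκ hw hslope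
  have hcont : Continuous fun t => κ * ε * slope (M' • g' t) :=
    continuous_const.mul (continuous_slope.comp (hg'.continuous.const_smul M'))
  obtain ⟨t', ht'⟩ := mem_range_of_exists_le_of_exists_ge (c := 0) hcont
    ⟨-T, (h2 _ le_rfl).le⟩ ⟨T, (h1 _ le_rfl).le⟩
  have hκε : κ * ε ≠ 0 := left_ne_zero_of_mul (h1 T le_rfl).ne'
  obtain ⟨s', hs'⟩ := hM'.mem_range ((mul_eq_zero.1 ht').resolve_left hκε)
  refine ⟨t', s', hs'.symm, fun hr => ?_⟩
  obtain ⟨s, hs⟩ : g' T ∈ Set.range h' := hr ▸ ⟨T, rfl⟩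
  have := h1 T le_rfl
  rw [← hs, hM'.slope_eq_zero, mul_zero] at this
  exact lt_irrefl _ this

/-- The order of crossings with disjoint lines is preserved. -/
lemma lt_of_crossing_lt (hφ : IsCoarse φ) (hφ' : IsCoarse φ.symm) {h₁ h₁' h₂ h₂' : ℝ → ℍ}
    (hgg' : IsClose φ g g') (hh₁h₁' : IsClose φ h₁ h₁') (hh₂h₂' : IsClose φ h₂ h₂')
    (hg : IsGeodesicLine g) (hg' : IsGeodesicLine g') (hh₁ : IsGeodesicLine h₁)
    (hh₁' : IsGeodesicLine h₁') (hh₂ : IsGeodesicLine h₂) (hh₂' : IsGeodesicLine h₂')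
    {t₁ t₂ t₁' t₂' s₁ s₂ s₁' s₂' : ℝ}
    (e₁ : g t₁ = h₁ s₁) (e₂ : g t₂ = h₂ s₂) (e₁' : g' t₁' = h₁' s₁') (e₂' : g' t₂' = h₂' s₂')
    (hne : Set.range g ≠ Set.range h₁) (hne' : Set.range g' ≠ Set.range h₁')
    (hd : ∀ s t, h₁ s = h₂ t → Set.range h₂ = Set.range h₁)
    (hd' : ∀ s t, h₁' s = h₂' t → Set.range h₂' = Set.range h₁') (hlt : t₁ < t₂) :
    t₁' < t₂' := by
  obtain ⟨M, hM⟩ := hh₁.exists_isFrame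
  obtain ⟨M', hM'⟩ := hh₁'.exists_isFrame
  obtain ⟨ε, hε⟩ := exists_side hφ hφ' hh₁h₁' hM hM'
  obtain ⟨κ, w, hκ, hw, hslope, -⟩ := hg.exists_slope_eq_sinh M
    (t₀ := t₁) (by rw [e₁, hM.slope_eq_zero]) (hg.exists_slope_ne_zero hM hne)
  obtain ⟨κ', w', hκ', hw', hslope', -⟩ := hg'.exists_slope_eq_sinh M'
    (t₀ := t₁') (by rw [e₁', hM'.slope_eq_zero]) (hg'.exists_slope_ne_zero hM' hne')
  -- Evaluating at a late time shows that `g'` crosses `h₁'` in the direction matching that of `g`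
  -- across `h₁`.
  have hsign : 0 < κ * ε * κ' := by
    obtain ⟨T, hT, -⟩ := exists_slope_mul_pos hε hgg' hκ hw hslope
    have h1 := hT (max T (t₁' + 1)) (le_max_left _ _)
    rw [hslope', ← mul_assoc] at h1
    have h2 : 0 < Real.sinh (w' * (max T (t₁' + 1) - t₁')) :=
      Real.sinh_pos_iff.2 (mul_pos hw' (by linarith [le_max_right T (t₁' + 1)]))
    exact pos_of_mul_pos_left h1 h2.le
  have hdisj : ∀ {N : SL(2, ℝ)} {k l : ℝ → ℍ}, IsFrame N k →
      (∀ s t, k s = l t → Set.range l = Set.range k) → (∃ t, slope (N • l t) ≠ 0) →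
      ∀ t, slope (N • l t) ≠ 0 := by
    rintro N k l hN hkl ⟨t₀, ht₀⟩ t ht
    obtain ⟨s, hs⟩ := hN.mem_range ht
    obtain ⟨s₀, hs₀⟩ : l t₀ ∈ Set.range k := hkl s t hs ▸ ⟨t₀, rfl⟩
    exact ht₀ (by rw [← hs₀, hN.slope_eq_zero])
  have hpos₂ : 0 < κ * slope (M • h₂ s₂) := by
    rw [← e₂, hslope, ← mul_assoc]
    exact mul_pos (mul_self_pos.2 hκ) (Real.sinh_pos_iff.2 (mul_pos hw (by linarith)))
  have hpos : ∀ s, 0 < κ * slope (M • h₂ s) := mul_pos_of_forall_ne_zero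
    (continuous_slope.comp (hh₂.continuous.const_smul M))
    (hdisj hM hd ⟨s₂, right_ne_zero_of_mul hpos₂.ne'⟩) hpos₂
  -- All of `h₂` lies on the side that `g` enters, and it goes arbitrarily far from `h₁`. At a far
  -- point `φ` determines the side of `h₂'`, and disjointness extends this to all of `h₂'`.
  have hfar : ∃ s, 0 < κ * ε * slope (M' • h₂' s) := by
    obtain ⟨K, hK⟩ := hh₂h₂'
    obtain ⟨R, hR⟩ := hε K
    obtain ⟨s, hs⟩ := hh₂.exists_slope_gt M ⟨s₂, right_ne_zero_of_mul hpos₂.ne'⟩ R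
    refine ⟨s, ?_⟩
    have h1 := hpos s
    rw [mul_assoc]
    rcases lt_or_gt_of_ne hκ with h | h
    · have h2 : slope (M • h₂ s) < 0 := (neg_iff_neg_of_mul_pos h1).1 h
      rw [abs_of_neg h2] at hs
      exact mul_pos_of_neg_of_neg h ((hR _ _ (hK s)).2 (by linarith))
    · have h2 : 0 < slope (M • h₂ s) := (pos_iff_pos_of_mul_pos h1).1 h
      rw [abs_of_pos h2] at hs
      exact mul_pos h ((hR _ _ (hK s)).1 hs)
  obtain ⟨s, hs⟩ := hfar
  have hpos' := mul_pos_of_forall_ne_zero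
    (continuous_slope.comp (hh₂'.continuous.const_smul M'))
    (hdisj hM' hd' ⟨s, right_ne_zero_of_mul hs.ne'⟩) hs s₂'
  simp only [Function.comp, Pi.smul_apply] at hpos'
  rw [← e₂', hslope', ← mul_assoc] at hpos'
  have h1 := Real.sinh_pos_iff.1 ((pos_iff_pos_of_mul_pos hpos').1 hsign)
  have := pos_of_mul_pos_right h1 hw'.le
  linarith

end UpperHalfPlane

/-! ### Discreteness, enumeration and correspondence of crossings -/

namespace MarkedHyperbolicStructure

variable {S : Type*} [TopologicalSpace S] {X Y : MarkedHyperbolicStructure S}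

lemma range_smul_ne {g h : ℝ → ℍ} (A : SL(2, ℝ)) (hne : Set.range g ≠ Set.range h) :
    (Set.range fun t => A • g t) ≠ Set.range fun t => A • h t := by
  intro he
  apply hne
  have hinj : Function.Injective fun z : ℍ => A • z := MulAction.injective A
  refine hinj.image_injective ?_
  rw [← Set.range_comp, ← Set.range_comp]
  exact he

/-- Crossings can be detected on any fixed lift. -/
lemma crossesAt_iff_exists {a c : ClosedCurve S} {g : ℝ → ℍ} (hg : X.IsGeodesicLift a g) {t : ℝ} :
    X.CrossesAt a c t ↔ ∃ h, X.IsGeodesicLift c h ∧ (∃ s, g t = h s) ∧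
      Set.range g ≠ Set.range h := by
  constructor
  · rintro ⟨g', h, hg', hh, ⟨s, hs⟩, hne⟩
    obtain ⟨A, hA, hAg⟩ := hg'.isLift.exists_deck hg.isLift
    refine ⟨fun t => A • h t, hh.smul hA, ⟨s, by rw [hAg, hs]⟩, ?_⟩
    rw [funext hAg]
    exact range_smul_ne A hne
  · rintro ⟨h, hh, hs, hne⟩
    exact ⟨g, h, hg, hh, hs, hne⟩

lemma CrossesAt.add_int {a c : ClosedCurve S} {t : ℝ} (h : X.CrossesAt a c t) (m : ℤ) :
    X.CrossesAt a c (t + m) := by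
  obtain ⟨g, h, hg, hh, ⟨s, hs⟩, hne⟩ := h
  refine ⟨fun t => g (t + (-m : ℤ)), h, hg.comp_add_int (-m), hh, ⟨s, by simpa using hs⟩, ?_⟩
  have : (Set.range fun t => g (t + (-m : ℤ))) = Set.range g :=
    (add_right_surjective ((-m : ℤ) : ℝ)).range_comp g
  rwa [this]

/-- A lift is determined by its value at `0` and crosses `g` at most once. After an integer shift of
its parameter, a lift crossing `g` on `[α, β]` starts in a fixed ball, which contains finitely many
points over `c 0`. -/
lemma finite_setOf_crossesAt [T1Space S] {a c : ClosedCurve S} (ha : X.IsClosedGeodesic a)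
    (hc : X.IsClosedGeodesic c) (α β : ℝ) : ({t | X.CrossesAt a c t} ∩ Set.Icc α β).Finite := by
  obtain ⟨g, hg⟩ := ha
  obtain ⟨h₀, hh₀⟩ := hc
  obtain ⟨r, hr⟩ := ((isCompact_Icc (a := α) (b := β)).image
    hg.1.continuous).isBounded.subset_closedBall UpperHalfPlane.I
  obtain ⟨r', hr'⟩ := ((isCompact_Icc (a := (0 : ℝ)) (b := 1)).image
    hh₀.1.continuous).isBounded.subset_closedBall (h₀ 0)
  refine Set.Finite.subset (Set.Finite.biUnion
    (X.finite_fiber_inter_closedBall (c 0) UpperHalfPlane.I (r + r'))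
    (t := fun p => {t | ∃ h, X.IsGeodesicLift c h ∧ h 0 = p ∧ (∃ s, g t = h s) ∧
      Set.range g ≠ Set.range h}) fun p _ => Set.Subsingleton.finite ?_) ?_
  · rintro t₁ ⟨h, hh, rfl, ⟨s₁, hs₁⟩, hne⟩ t₂ ⟨h', hh', hp, ⟨s₂, hs₂⟩, -⟩
    obtain rfl := hh'.isLift.eq hh.isLift hp
    by_contra ht
    obtain ⟨M, hM⟩ := hh.1.exists_isFrame
    obtain ⟨t, ht'⟩ := hg.1.exists_slope_ne_zero hM hne
    exact ht' (hg.1.slope_eq_zero_of_two_zeros M ht (by rw [hs₁, hM.slope_eq_zero])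
      (by rw [hs₂, hM.slope_eq_zero]) t)
  · rintro t ⟨hcross, ht⟩
    obtain ⟨h, hh, ⟨s, hs⟩, hne⟩ := (crossesAt_iff_exists hg).1 hcross
    have hh' := hh.comp_add_int ⌊s⌋
    have hrange : (Set.range fun t => h (t + (⌊s⌋ : ℤ))) = Set.range h :=
      (add_right_surjective ((⌊s⌋ : ℤ) : ℝ)).range_comp h
    refine Set.mem_biUnion (x := h (0 + (⌊s⌋ : ℤ))) ⟨?_, ?_⟩
      ⟨_, hh', rfl, ⟨Int.fract s, by rw [Int.fract_add_floor, hs]⟩, by rwa [hrange]⟩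
    · exact (hh'.2 0).trans (by rw [QuotientAddGroup.mk_zero])
    · obtain ⟨A, -, hA⟩ := hh₀.isLift.exists_deck hh'.isLift
      have h1 := hr' ⟨Int.fract s, ⟨Int.fract_nonneg s, (Int.fract_lt_one s).le⟩, rfl⟩
      have h2 := hr ⟨t, ht, rfl⟩
      rw [Metric.mem_closedBall] at h1 h2 ⊢
      rw [← dist_smul A, ← hA, ← hA, Int.fract_add_floor, ← hs] at h1
      rw [dist_comm] at h1
      linarith [dist_triangle (h (0 + (⌊s⌋ : ℤ))) (g t) UpperHalfPlane.I]

end MarkedHyperbolicStructure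

/-- Local finiteness gives successors and predecessors with the Archimedean property; translation
invariance excludes endpoints. -/
lemma Set.nonempty_orderIso_int {T : Set ℝ} (hne : T.Nonempty)
    (hadd : ∀ t ∈ T, ∀ m : ℤ, t + m ∈ T) (hfin : ∀ α β, (T ∩ Set.Icc α β).Finite) :
    Nonempty (T ≃o ℤ) := by
  let _ : LocallyFiniteOrder T := LocallyFiniteOrder.ofFiniteIcc fun x y => by
    refine Set.Finite.of_finite_image (f := Subtype.val) ((hfin x y).subset ?_)
      Subtype.val_injective.injOn
    rintro _ ⟨z, hz, rfl⟩
    exact ⟨z.2, hz⟩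
  let _ : SuccOrder T := LinearLocallyFiniteOrder.succOrder T
  let _ : PredOrder T := LinearLocallyFiniteOrder.predOrder T
  have : NoMaxOrder T := ⟨fun t => ⟨⟨t + (1 : ℤ), hadd t t.2 1⟩, by
    rw [← Subtype.coe_lt_coe]; simp⟩⟩
  have : NoMinOrder T := ⟨fun t => ⟨⟨t + (-1 : ℤ), hadd t t.2 (-1)⟩, by
    rw [← Subtype.coe_lt_coe]; simp⟩⟩
  have : Nonempty T := hne.to_subtype
  exact ⟨orderIsoIntOfLinearSuccPredArch⟩

namespace MarkedHyperbolicStructure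

variable {S : Type*} [TopologicalSpace S] {X Y : MarkedHyperbolicStructure S}

lemma nonempty_crossingSequence [T1Space S] {n : ℕ} {a : ClosedCurve S} {b : Fin n → ClosedCurve S}
    (ha : X.IsClosedGeodesic a) (hb : ∀ i, X.IsClosedGeodesic (b i))
    (hinj : ∀ i j t, X.CrossesAt a (b i) t → X.CrossesAt a (b j) t → i = j) :
    Nonempty (X.CrossingSequence a b Empty) ∨ Nonempty (X.CrossingSequence a b ℤ) := by
  by_cases hne : {t | ∃ i, X.CrossesAt a (b i) t}.Nonempty
  · right
    obtain ⟨e⟩ := Set.nonempty_orderIso_int hne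
      (fun t ⟨i, ht⟩ m => ⟨i, ht.add_int m⟩)
      (fun α β => by
        refine (Set.finite_iUnion fun i => finite_setOf_crossesAt ha (hb i) α β).subset ?_
        rintro t ⟨⟨i, hi⟩, ht⟩
        exact Set.mem_iUnion.2 ⟨i, hi, ht⟩)
    have hidx : ∀ k : ℤ, ∃ i, X.CrossesAt a (b i) (e.symm k : ℝ) := fun k => (e.symm k).2
    choose idx hidx using hidx
    refine ⟨⟨fun k => e.symm k, fun k l h => e.symm.strictMono h, idx, fun t i => ⟨fun h => ?_, ?_⟩⟩⟩
    · refine ⟨e ⟨t, i, h⟩, by simp, ?_⟩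
      have h' := hidx (e ⟨t, i, h⟩)
      rw [e.symm_apply_apply] at h'
      exact hinj _ _ _ h' h
    · rintro ⟨k, rfl, rfl⟩
      exact hidx k
  · left
    refine ⟨⟨Empty.elim, fun k => k.elim, Empty.elim, fun t i => ⟨fun h => ?_, ?_⟩⟩⟩
    · exact absurd ⟨t, i, h⟩ hne
    · rintro ⟨k, -⟩
      exact k.elim

/-- Every geodesic lift has a counterpart at bounded distance for another structure. -/
lemma IsGeodesicLift.exists_close {φ : ℍ ≃ₜ ℍ} (hφ : ∀ z, Y.proj (φ z) = X.proj z)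
    {c c' : ClosedCurve S} {h : ℝ → ℍ} (hh : X.IsGeodesicLift c h) (hc' : Y.IsClosedGeodesic c')
    (hcc' : c.Homotopic c') : ∃ h', Y.IsGeodesicLift c' h' ∧ IsClose φ h h' ∧
      ∀ (m : ℤ) (A), Y.IsDeck A → (∀ t, φ (h (t + m)) = A • φ (h t)) →
        ∀ t, h' (t + m) = A • h' t := by
  have hl : Y.IsLift c fun t => φ (h t) :=
    ⟨φ.continuous.comp hh.1.continuous, fun t => by rw [hφ, hh.2]⟩
  obtain ⟨h', hh', hK, hdeck⟩ := hl.exists_lift_of_homotopic hcc'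
  exact ⟨h', hh'.isGeodesicLift hc', hK, hdeck⟩

/-- The crossing at time `t` with a curve of the family `b` corresponds to the crossing at time `t'`
with the curve of the family `b'` of the same index. -/
def CorrespondingCrossing (X Y : MarkedHyperbolicStructure S) (φ : ℍ → ℍ) (g g' : ℝ → ℍ)
    (c c' : ClosedCurve S) (t t' : ℝ) : Prop :=
  ∃ h h' : ℝ → ℍ, X.IsGeodesicLift c h ∧ Y.IsGeodesicLift c' h' ∧ IsClose φ h h' ∧
    (∃ s, g t = h s) ∧ (∃ s, g' t' = h' s) ∧ Set.range g ≠ Set.range h ∧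
      Set.range g' ≠ Set.range h'

variable {φ : ℍ ≃ₜ ℍ} {g g' : ℝ → ℍ}

lemma exists_correspondingCrossing (hφ : ∀ z, Y.proj (φ z) = X.proj z) (hc : IsCoarse φ)
    (hc' : IsCoarse φ.symm) {a a' c c' : ClosedCurve S} (hg : X.IsGeodesicLift a g)
    (hg' : Y.IsGeodesicLift a' g') (hgg' : IsClose φ g g') (hY : Y.IsClosedGeodesic c')
    (hcc' : c.Homotopic c') {t : ℝ} (ht : X.CrossesAt a c t) :
    ∃ t', CorrespondingCrossing X Y φ g g' c c' t t' := by
  obtain ⟨h, hh, ⟨s, hs⟩, hne⟩ := (crossesAt_iff_exists hg).1 ht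
  obtain ⟨h', hh', hclose, -⟩ := hh.exists_close hφ hY hcc'
  obtain ⟨t', s', h1, h2⟩ :=
    exists_crossing_of_crossing hc hc' hgg' hclose hg.1 hg'.1 hh.1 hh'.1 hs hne
  exact ⟨t', h, h', hh, hh', hclose, ⟨s, hs⟩, ⟨s', h1⟩, hne, h2⟩

lemma CorrespondingCrossing.symm (hc' : IsCoarse φ.symm) {c c' : ClosedCurve S} {t t' : ℝ}
    (h : CorrespondingCrossing X Y φ g g' c c' t t') :
    CorrespondingCrossing Y X φ.symm g' g c' c t' t := by
  obtain ⟨h, h', hh, hh', hcl, h1, h2, h3, h4⟩ := h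
  exact ⟨h', h, hh', hh, hcl.symm hc', h2, h1, h4, h3⟩

lemma CorrespondingCrossing.lt (hc : IsCoarse φ) (hc' : IsCoarse φ.symm)
    (hg : IsGeodesicLine g) (hg' : IsGeodesicLine g') (hgg' : IsClose φ g g')
    {c₁ c₁' c₂ c₂' : ClosedCurve S}
    (hX : ∀ h₁ h₂ s t, X.IsGeodesicLift c₁ h₁ → X.IsGeodesicLift c₂ h₂ → h₁ s = h₂ t →
      Set.range h₂ = Set.range h₁)
    (hY : ∀ h₁ h₂ s t, Y.IsGeodesicLift c₁' h₁ → Y.IsGeodesicLift c₂' h₂ → h₁ s = h₂ t →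
      Set.range h₂ = Set.range h₁) {t₁ t₁' t₂ t₂' : ℝ}
    (h₁ : CorrespondingCrossing X Y φ g g' c₁ c₁' t₁ t₁')
    (h₂ : CorrespondingCrossing X Y φ g g' c₂ c₂' t₂ t₂') (hlt : t₁ < t₂) : t₁' < t₂' := by
  obtain ⟨k, k', hk, hk', hkcl, ⟨s, hs⟩, ⟨s', hs'⟩, hne, hne'⟩ := h₁
  obtain ⟨l, l', hl, hl', hlcl, ⟨u, hu⟩, ⟨u', hu'⟩, -, -⟩ := h₂
  exact lt_of_crossing_lt hc hc' hgg' hkcl hlcl hg hg' hk.1 hk'.1 hl.1 hl'.1 hs hu hs' hu' hne hne'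
    (fun s t => hX k l s t hk hl) (fun s t => hY k' l' s t hk' hl') hlt

lemma CorrespondingCrossing.add_one {c c' : ClosedCurve S} {t t' : ℝ} {A B : SL(2, ℝ)}
    (hA : X.IsDeck A) (hB : Y.IsDeck B) (hAB : ∀ z, φ (A • z) = B • φ z)
    (hgA : ∀ t, g (t + 1) = A • g t) (hgB : ∀ t, g' (t + 1) = B • g' t)
    (h : CorrespondingCrossing X Y φ g g' c c' t t') :
    CorrespondingCrossing X Y φ g g' c c' (t + 1) (t' + 1) := by
  obtain ⟨h, h', hh, hh', ⟨K, hK⟩, ⟨s, hs⟩, ⟨s', hs'⟩, hne, hne'⟩ := h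
  have hrange : ∀ (f : ℝ → ℍ) (C : SL(2, ℝ)), (∀ t, f (t + 1) = C • f t) →
      Set.range f = Set.range fun t => C • f t := fun f C hf => by
    rw [← funext hf]
    exact ((add_right_surjective (1 : ℝ)).range_comp f).symm
  refine ⟨fun t => A • h t, fun t => B • h' t, hh.smul hA, hh'.smul hB,
    ⟨K, fun t => by rw [hAB, dist_smul]; exact hK t⟩, ⟨s, by rw [hgA, hs]⟩,
    ⟨s', by rw [hgB, hs']⟩, ?_, ?_⟩
  · rw [hrange g A hgA]; exact range_smul_ne A hne
  · rw [hrange g' B hgB]; exact range_smul_ne B hne'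

end MarkedHyperbolicStructure

/-! ### Assembling the order isomorphism -/

namespace ClosedCurve

variable {S : Type*} [TopologicalSpace S]

lemma reverse_homotopic {c d : ClosedCurve S} (h : c.Homotopic d) :
    c.reverse.Homotopic d.reverse :=
  h.comp (ContinuousMap.Homotopic.refl _)

end ClosedCurve

namespace MarkedHyperbolicStructure

variable {S : Type*} [TopologicalSpace S] {X Y : MarkedHyperbolicStructure S}

/-- Geodesic representatives of disjointly realizable curves: lifts that meet have the same range,
and belong to the same curve. -/
lemma range_eq_and_eq_of_meet {n : ℕ} {γs b : Fin n → ClosedCurve S}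
    (hdistinct : ClosedCurve.PairwiseDistinct γs) (hdisjoint : ClosedCurve.DisjointlyRealizable γs)
    (hb : ∀ i, (γs i).Homotopic (b i)) {i j : Fin n} {h₁ h₂ : ℝ → ℍ} {s t : ℝ}
    (hh₁ : X.IsGeodesicLift (b i) h₁) (hh₂ : X.IsGeodesicLift (b j) h₂) (hst : h₁ s = h₂ t) :
    Set.range h₂ = Set.range h₁ ∧ i = j := by
  obtain ⟨δ, hγδ, hsimple, hdisj⟩ := hdisjoint
  have hbδ : ∀ i, (b i).Homotopic (δ i) := fun i => (hb i).symm.trans (hγδ i)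
  have hr := range_eq_of_meet hh₁ hh₂ (hbδ i) (hbδ j) (fun x y hxy => by
    obtain rfl : i = j := by
      by_contra hij
      exact Set.disjoint_left.1 (hdisj i j hij) ⟨x, rfl⟩ (hxy ▸ ⟨y, rfl⟩)
    exact ⟨rfl, hsimple i hxy⟩) hst
  refine ⟨hr, ?_⟩
  by_contra hij
  rcases homotopic_or_homotopic_reverse hh₁ hh₂ (hbδ i) (hbδ j) (hsimple i) (hsimple j) hr with h | h
  · exact (hdistinct i j hij).1 (((hb i).trans h).trans (hb j).symm)
  · exact (hdistinct j i (Ne.symm hij)).2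
      (((ClosedCurve.reverse_homotopic (hb i)).trans h).trans (hb j).symm).symm

lemma CorrespondingCrossing.crossesAt {φ : ℍ → ℍ} {g g' : ℝ → ℍ} {a c c' : ClosedCurve S}
    {t t' : ℝ} (hg : X.IsGeodesicLift a g) (h : CorrespondingCrossing X Y φ g g' c c' t t') :
    X.CrossesAt a c t := by
  obtain ⟨h, -, hh, -, -, h1, -, h2, -⟩ := h
  exact ⟨g, h, hg, hh, h1, h2⟩

/-- Two crossing sequences related by an order preserving correspondence of crossings are
isomorphic. -/
lemma CrossingSequence.exists_orderIso {n : ℕ} {a a' : ClosedCurve S} {b b' : Fin n → ClosedCurve S}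
    {I J : Type} [LinearOrder I] [LinearOrder J] (c : X.CrossingSequence a b I)
    (d : Y.CrossingSequence a' b' J) {R : Fin n → ℝ → ℝ → Prop}
    (hR : ∀ i t, X.CrossesAt a (b i) t → ∃ t', R i t t')
    (hR' : ∀ i t', Y.CrossesAt a' (b' i) t' → ∃ t, R i t t')
    (hX : ∀ i t t', R i t t' → X.CrossesAt a (b i) t)
    (hY : ∀ i t t', R i t t' → Y.CrossesAt a' (b' i) t')
    (hlt : ∀ i j t₁ t₁' t₂ t₂', R i t₁ t₁' → R j t₂ t₂' → (t₁ < t₂ ↔ t₁' < t₂'))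
    (hadd : ∀ i t t', R i t t' → R i (t + 1) (t' + 1)) :
    ∃ e : I ≃o J, (∀ k, c.index k = d.index (e k)) ∧
      ∀ k l, c.time l = c.time k + 1 → d.time (e l) = d.time (e k) + 1 := by
  -- Preservation of order in both directions makes the relation single-valued, even across
  -- different indices.
  have heq : ∀ i j t t₁' t₂', R i t t₁' → R j t t₂' → t₁' = t₂' := fun i j t t₁' t₂' h₁ h₂ =>
    le_antisymm (not_lt.1 fun h => lt_irrefl _ ((hlt j i _ _ _ _ h₂ h₁).2 h))
      (not_lt.1 fun h => lt_irrefl _ ((hlt i j _ _ _ _ h₁ h₂).2 h))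
  have hex : ∀ k : I, ∃ l : J, d.index l = c.index k ∧ R (c.index k) (c.time k) (d.time l) := by
    intro k
    obtain ⟨t', ht'⟩ := hR _ _ ((c.crossesAt_iff _ _).2 ⟨k, rfl, rfl⟩)
    obtain ⟨l, rfl, hl⟩ := (d.crossesAt_iff _ _).1 (hY _ _ _ ht')
    exact ⟨l, hl, ht'⟩
  choose f hindex hf using hex
  have hmono : StrictMono f := fun k l hkl =>
    d.strictMono_time.lt_iff_lt.1 ((hlt _ _ _ _ _ _ (hf k) (hf l)).1 (c.strictMono_time hkl))
  have hsurj : Function.Surjective f := by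
    intro l
    obtain ⟨t, ht⟩ := hR' _ _ ((d.crossesAt_iff _ _).2 ⟨l, rfl, rfl⟩)
    obtain ⟨k, rfl, -⟩ := (c.crossesAt_iff _ _).1 (hX _ _ _ ht)
    exact ⟨k, d.strictMono_time.injective (heq _ _ _ _ _ (hf k) ht)⟩
  refine ⟨hmono.orderIsoOfSurjective f hsurj, fun k => (hindex k).symm, fun k l hkl => ?_⟩
  have h := hf l
  rw [hkl] at h
  exact heq _ _ _ _ _ h (hadd _ _ _ (hf k))

end MarkedHyperbolicStructure

theorem mainTheorem8 {S : Type*} [TopologicalSpace S] [T2Space S] [CompactSpace S]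
    [ConnectedSpace S] [ChartedSpace (EuclideanSpace ℝ (Fin 2)) S]
    {n : ℕ} (γs : Fin n → ClosedCurve S) (hsimple : ∀ i, (γs i).IsSimple)
    (hdistinct : ClosedCurve.PairwiseDistinct γs)
    (hdisjoint : ClosedCurve.DisjointlyRealizable γs)
    (γ : ClosedCurve S)
    (X : Fin 2 → MarkedHyperbolicStructure S)
    (b : Fin 2 → Fin n → ClosedCurve S)
    (hb : ∀ j i, (X j).IsGeodesicRealization (γs i) (b j i))
    (a : Fin 2 → ClosedCurve S)
    (ha : ∀ j, (X j).IsGeodesicRealization γ (a j)) :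
    (∀ j, Nonempty ((X j).CrossingSequence (a j) (b j) Empty) ∨
      Nonempty ((X j).CrossingSequence (a j) (b j) ℤ)) ∧
    ∀ (I₁ I₂ : Type) [LinearOrder I₁] [LinearOrder I₂]
      (c₁ : (X 0).CrossingSequence (a 0) (b 0) I₁)
      (c₂ : (X 1).CrossingSequence (a 1) (b 1) I₂),
      ∃ e : I₁ ≃o I₂, (∀ k, c₁.index k = c₂.index (e k)) ∧
        ∀ k l, c₁.time l = c₁.time k + 1 → c₂.time (e l) = c₂.time (e k) + 1 := by
  have hmeet : ∀ m (i j : Fin n) (h₁ h₂ : ℝ → ℍ) (s t : ℝ), (X m).IsGeodesicLift (b m i) h₁ →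
      (X m).IsGeodesicLift (b m j) h₂ → h₁ s = h₂ t → Set.range h₂ = Set.range h₁ ∧ i = j :=
    fun m i j h₁ h₂ s t hh₁ hh₂ hst =>
      MarkedHyperbolicStructure.range_eq_and_eq_of_meet hdistinct hdisjoint
        (fun i => (hb m i).2) hh₁ hh₂ hst
  refine ⟨fun m => MarkedHyperbolicStructure.nonempty_crossingSequence (ha m).1
    (fun i => (hb m i).1) fun i j t hi hj => ?_, ?_⟩
  · obtain ⟨g, hg⟩ := (ha m).1
    obtain ⟨h₁, hh₁, ⟨s₁, hs₁⟩, -⟩ := (MarkedHyperbolicStructure.crossesAt_iff_exists hg).1 hi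
    obtain ⟨h₂, hh₂, ⟨s₂, hs₂⟩, -⟩ := (MarkedHyperbolicStructure.crossesAt_iff_exists hg).1 hj
    exact (hmeet m i j h₁ h₂ s₁ s₂ hh₁ hh₂ (hs₁.symm.trans hs₂)).2
  · intro I₁ I₂ _ _ c₁ c₂
    obtain ⟨φ, hφ⟩ := MarkedHyperbolicStructure.exists_homeomorph (X 0) (X 1)
    have hφ' : ∀ z, (X 0).proj (φ.symm z) = (X 1).proj z := fun z => by
      rw [← hφ, φ.apply_symm_apply]
    have hc : IsCoarse φ := MarkedHyperbolicStructure.exists_dist_le hφ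
    have hc' : IsCoarse φ.symm := MarkedHyperbolicStructure.exists_dist_le hφ'
    have hbb : ∀ i, (b 0 i).Homotopic (b 1 i) := fun i => (hb 0 i).2.symm.trans (hb 1 i).2
    obtain ⟨g, hg⟩ := (ha 0).1
    obtain ⟨g', hg', hgg', hdeck⟩ := hg.exists_close hφ (ha 1).1 ((ha 0).2.symm.trans (ha 1).2)
    obtain ⟨A, hA, hgA⟩ := hg.isLift.exists_deck_add_int 1
    obtain ⟨B, hB, hAB⟩ := hA.exists_conj hφ
    -- The period of `g'` is realized by the conjugate `B` of the deck transformation `A` for `g`;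
    -- this makes the correspondence compatible with traversals.
    have hgB := hdeck 1 B hB fun t => by rw [hgA, hAB]
    simp only [Int.cast_one] at hgA hgB
    refine c₁.exists_orderIso c₂ (R := fun i =>
      MarkedHyperbolicStructure.CorrespondingCrossing (X 0) (X 1) φ g g' (b 0 i) (b 1 i))
      (fun i t ht => MarkedHyperbolicStructure.exists_correspondingCrossing hφ hc hc' hg hg' hgg'
        (hb 1 i).1 (hbb i) ht)
      (fun i t' ht' => ?_) (fun i t t' h => h.crossesAt hg)
      (fun i t t' h => (h.symm hc').crossesAt hg')
      (fun i j t₁ t₁' t₂ t₂' h₁ h₂ => ⟨fun hlt => ?_, fun hlt => ?_⟩)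
      (fun i t t' h => h.add_one hA hB hAB hgA hgB)
    · obtain ⟨t, ht⟩ := MarkedHyperbolicStructure.exists_correspondingCrossing hφ' hc' hc hg' hg
        (hgg'.symm hc') (hb 0 i).1 (hbb i).symm ht'
      exact ⟨t, ht.symm (φ := φ.symm) hc⟩
    · exact MarkedHyperbolicStructure.CorrespondingCrossing.lt hc hc' hg.1 hg'.1 hgg'
        (fun k l s t hk hl hkl => (hmeet 0 i j k l s t hk hl hkl).1)
        (fun k l s t hk hl hkl => (hmeet 1 i j k l s t hk hl hkl).1) h₁ h₂ hlt
    · exact MarkedHyperbolicStructure.CorrespondingCrossing.lt (φ := φ.symm) hc' hc hg'.1 hg.1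
        (hgg'.symm hc') (fun k l s t hk hl hkl => (hmeet 1 i j k l s t hk hl hkl).1)
        (fun k l s t hk hl hkl => (hmeet 0 i j k l s t hk hl hkl).1)
        (h₁.symm hc') (h₂.symm hc') hlt
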